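/- Let $k$ be a field and let $B$ be a Poisson Hopf algebra over $k$, that is, a commutative Hopf algebra with a $k$-bilinear Lie bracket $\{\cdot,\cdot\}$ satisfying $\{a,bc\}=\{a,b\}c+b\{a,c\}$ and $\Delta(\{a,b\})=\{\Delta(a),\Delta(b)\}$ for all $a,b,c\in B$, where $\{a\otimes b,c\otimes d\}=ac\otimes\{b,d\}+\{a,c\}\otimes bd$ on $B\otimes B$. Let $B^e$ be the universal enveloping algebra of the Poisson algebra $B$: the unital associative $k$-algebra generated by two copies $\{m_a\}_{a\in B}$ and $\{h_a\}_{a\in B}$ of the vector space $B$ subject to the relations $$m_{xy}=m_xm_y,\quad h_{\{x,y\}}=h_xh_y-h_yh_x,\quad h_{xy}=m_yh_x+m_xh_y,\quad m_{\{x,y\}}=h_xm_y-m_yh_x,\quad m_1=1 .$$ It is a Hopf algebra with $$\Delta(m_a)=\sum m_{a_1}\otimes m_{a_2},\quad \varepsilon(m_a)=\varepsilon(a),\quad \Delta(h_a)=\sum (m_{a_1}\otimes h_{a_2}+h_{a_1}\otimes m_{a_2}),\quad \varepsilon(h_a)=0,$$ and $m\colon B\to B^e$, $a\mapsto m_a$,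 is an injective map of Hopf algebras, by which $B$ is regarded as a Hopf subalgebra of $B^e$. The coradical of a coalgebra is the sum of its simple subcoalgebras; a coalgebra $C$ is pointed if its coradical is the span of its set $G(C)$ of group-like elements. Then the coradical of $B^e$ is equal to the coradical of $B$ (that is, to its image under $m$). In particular, if $B$ is pointed, then $B^e$ is pointed and $G(B^e)=G(B)$ (that is, $G(B^e)=m(G(B))$). -/

import Mathlib

open scoped TensorProduct

set_option linter.unusedSectionVars false

noncomputable section

/-- A Poisson algebra over a field `k`: a commutative `k`-algebra with a `k`-bilinear Lie bracket
which is a derivation in each argument. -/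
class PoissonAlgebra (k A : Type*) [Field k] [CommRing A] [Algebra k A] where
  /-- The Poisson bracket. -/
  bracket (k) : A →ₗ[k] A →ₗ[k] A
  bracket_self (a : A) : bracket a a = 0
  jacobi (a b c : A) :
    bracket a (bracket b c) + bracket b (bracket c a) + bracket c (bracket a b) = 0
  leibniz (a b c : A) : bracket a (b * c) = bracket a b * c + b * bracket a c

namespace PoissonAlgebra

variable (k : Type*) {A : Type*} [Field k] [CommRing A] [Algebra k A] [PoissonAlgebra k A]

theorem bracket_skew (a b : A) : bracket k a b = -bracket k b a := by
  have h := bracket_self (k := k) (a + b)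
  simp only [map_add, LinearMap.add_apply, bracket_self, zero_add, add_zero] at h
  exact eq_neg_of_add_eq_zero_right h

theorem bracket_mul_left (a b c : A) :
    bracket k (a * b) c = bracket k a c * b + a * bracket k b c := by
  rw [bracket_skew k (a * b), leibniz, bracket_skew k c a, bracket_skew k c b]; ring

theorem bracket_one_right (a : A) : bracket k a 1 = 0 := by
  have h := leibniz (k := k) a 1 1
  simpa using h

theorem bracket_algebraMap_right (a : A) (r : k) : bracket k a (algebraMap k A r) = 0 := by
  rw [Algebra.algebraMap_eq_smul_one, map_smul, bracket_one_right, smul_zero]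

theorem bracket_algebraMap_left (a : A) (r : k) : bracket k (algebraMap k A r) a = 0 := by
  rw [bracket_skew, bracket_algebraMap_right, neg_zero]

variable (A) in
/-- The bracket of the Poisson algebra `A ⊗ A`:
`{a ⊗ b, c ⊗ d} = a c ⊗ {b, d} + {a, c} ⊗ b d`. -/
def tensorBracket : A ⊗[k] A →ₗ[k] A ⊗[k] A →ₗ[k] A ⊗[k] A :=
  TensorProduct.map₂ (LinearMap.mul k A) (bracket k) +
    TensorProduct.map₂ (bracket k) (LinearMap.mul k A)

@[simp]
theorem tensorBracket_tmul (a b c d : A) :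
    tensorBracket k A (a ⊗ₜ b) (c ⊗ₜ d) =
      (a * c) ⊗ₜ bracket k b d + bracket k a c ⊗ₜ (b * d) := rfl

end PoissonAlgebra

/-- A commutative bialgebra `B` with a Poisson bracket is a Poisson bialgebra if
`Δ {a, b} = {Δ a, Δ b}`. If `B` is a Hopf algebra, it is then a Poisson Hopf algebra. -/
class IsPoissonBialgebra (k B : Type*) [Field k] [CommRing B] [Bialgebra k B]
    [PoissonAlgebra k B] : Prop where
  comul_bracket (a b : B) :
    Coalgebra.comul (R := k) (PoissonAlgebra.bracket k a b) =
      PoissonAlgebra.tensorBracket k B (Coalgebra.comul a) (Coalgebra.comul b)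

/-! ### The universal enveloping algebra of a Poisson algebra -/

namespace PoissonEnv

open PoissonAlgebra

section Rel

variable (k A : Type*) [Field k] [CommRing A] [Algebra k A] [PoissonAlgebra k A]

/-- The generator `m_a`, in the tensor algebra on the direct sum of two copies of `A`. -/
def preM : A →ₗ[k] TensorAlgebra k (A × A) := TensorAlgebra.ι k ∘ₗ LinearMap.inl k A A

/-- The generator `h_a`, in the tensor algebra on the direct sum of two copies of `A`. -/
def preH : A →ₗ[k] TensorAlgebra k (A × A) := TensorAlgebra.ι k ∘ₗ LinearMap.inr k A A

/-- The defining relations of the enveloping algebra. -/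
inductive Rel : TensorAlgebra k (A × A) → TensorAlgebra k (A × A) → Prop
  | m_mul (x y : A) : Rel (preM k A (x * y)) (preM k A x * preM k A y)
  | h_bracket (x y : A) : Rel (preH k A (bracket k x y))
      (preH k A x * preH k A y - preH k A y * preH k A x)
  | h_mul (x y : A) : Rel (preH k A (x * y))
      (preM k A y * preH k A x + preM k A x * preH k A y)
  | m_bracket (x y : A) : Rel (preM k A (bracket k x y))
      (preH k A x * preM k A y - preM k A y * preH k A x)
  | m_one : Rel (preM k A 1) 1

end Rel

end PoissonEnv

/-- The universal enveloping algebra `A^e` of a Poisson algebra `A`. -/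
def PoissonEnv (k A : Type*) [Field k] [CommRing A] [Algebra k A]
    [PoissonAlgebra k A] :=
  RingQuot (PoissonEnv.Rel k A)

namespace PoissonEnv

open PoissonAlgebra

section Algebra

variable (k : Type*) {A : Type*} [Field k] [CommRing A] [Algebra k A] [PoissonAlgebra k A]

instance : Ring (PoissonEnv k A) :=
  inferInstanceAs (Ring (RingQuot (Rel k A)))

instance : Algebra k (PoissonEnv k A) :=
  inferInstanceAs (Algebra k (RingQuot (Rel k A)))

variable (A) in
/-- The quotient map from the tensor algebra. -/
def mk : TensorAlgebra k (A × A) →ₐ[k] PoissonEnv k A :=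
  RingQuot.mkAlgHom k (Rel k A)

theorem mk_rel {x y : TensorAlgebra k (A × A)} (h : Rel k A x y) : mk k A x = mk k A y :=
  RingQuot.mkAlgHom_rel k h

variable (A) in
/-- The structure map `m : A → A^e`, which is an algebra map. -/
def m : A →ₐ[k] PoissonEnv k A :=
  AlgHom.ofLinearMap ((mk k A).toLinearMap ∘ₗ preM k A)
    (by simpa using mk_rel k (Rel.m_one (k := k) (A := A)))
    (fun x y => by simpa using mk_rel k (Rel.m_mul (k := k) x y))

variable (A) in
/-- The structure map `h : A → A^e`. -/
def h : A →ₗ[k] PoissonEnv k A :=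
  (mk k A).toLinearMap ∘ₗ preH k A

theorem h_bracket (x y : A) :
    h k A (bracket k x y) = h k A x * h k A y - h k A y * h k A x := by
  have := mk_rel k (Rel.h_bracket (k := k) x y)
  simp only [map_sub, map_mul] at this
  exact this

theorem h_mul (x y : A) :
    h k A (x * y) = m k A y * h k A x + m k A x * h k A y := by
  have := mk_rel k (Rel.h_mul (k := k) x y)
  simp only [map_add, map_mul] at this
  exact this

theorem m_bracket (x y : A) :
    m k A (bracket k x y) = h k A x * m k A y - m k A y * h k A x := by
  have := mk_rel k (Rel.m_bracket (k := k) x y)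
  simp only [map_sub, map_mul] at this
  exact this

theorem h_one : h k A 1 = 0 := by
  have := h_mul k (1 : A) 1
  simpa using this

variable {k} {E : Type*} [Ring E] [Algebra k E]

/-- The universal property of `A^e`. -/
def lift (γ : A →ₐ[k] E) (δ : A →ₗ[k] E)
    (h₁ : ∀ x y, δ (bracket k x y) = δ x * δ y - δ y * δ x)
    (h₂ : ∀ x y, δ (x * y) = γ y * δ x + γ x * δ y)
    (h₃ : ∀ x y, γ (bracket k x y) = δ x * γ y - γ y * δ x) :
    PoissonEnv k A →ₐ[k] E :=
  RingQuot.liftAlgHom k ⟨TensorAlgebra.lift k (LinearMap.coprod γ.toLinearMap δ), by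
    intro x y hxy
    induction hxy with
    | m_mul x y => simp [preM]
    | h_bracket x y => simp [preH, h₁]
    | h_mul x y => simp [preM, preH, h₂]
    | m_bracket x y => simp [preM, preH, h₃]
    | m_one => simp [preM]⟩

section

variable (γ : A →ₐ[k] E) (δ : A →ₗ[k] E)
    (h₁ : ∀ x y, δ (bracket k x y) = δ x * δ y - δ y * δ x)
    (h₂ : ∀ x y, δ (x * y) = γ y * δ x + γ x * δ y)
    (h₃ : ∀ x y, γ (bracket k x y) = δ x * γ y - γ y * δ x)

@[simp]
theorem lift_m (x : A) : lift γ δ h₁ h₂ h₃ (m k A x) = γ x := by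
  refine (RingQuot.liftAlgHom_mkAlgHom_apply k _ _ _).trans ?_
  simp [preM]

@[simp]
theorem lift_h (x : A) : lift γ δ h₁ h₂ h₃ (h k A x) = δ x := by
  refine (RingQuot.liftAlgHom_mkAlgHom_apply k _ _ _).trans ?_
  simp [preH]

end

theorem algHom_ext {f g : PoissonEnv k A →ₐ[k] E}
    (hm : ∀ x, f (m k A x) = g (m k A x)) (hh : ∀ x, f (h k A x) = g (h k A x)) : f = g := by
  refine RingQuot.ringQuot_ext' (S := k) (s := Rel k A) f g (TensorAlgebra.hom_ext ?_)
  refine LinearMap.prod_ext ?_ ?_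
  · ext x; exact hm x
  · ext x; exact hh x

/-- `A^e` is generated by the elements `m_a` and `h_a` as an algebra. -/
theorem adjoin_eq_top :
    Algebra.adjoin k (Set.range (m k A) ∪ Set.range (h k A)) = ⊤ := by
  set S := Algebra.adjoin k (Set.range (m k A) ∪ Set.range (h k A)) with hS
  have hm : ∀ x, m k A x ∈ S := fun x => Algebra.subset_adjoin (Or.inl ⟨x, rfl⟩)
  have hh : ∀ x, h k A x ∈ S := fun x => Algebra.subset_adjoin (Or.inr ⟨x, rfl⟩)
  let f : PoissonEnv k A →ₐ[k] S :=
    lift ((m k A).codRestrict S hm) ((h k A).codRestrict (Subalgebra.toSubmodule S) hh)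
      (fun x y => Subtype.ext (h_bracket k x y)) (fun x y => Subtype.ext (h_mul k x y))
      (fun x y => Subtype.ext (m_bracket k x y))
  have hf : S.val.comp f = AlgHom.id k _ := by
    refine algHom_ext (fun x => ?_) (fun x => ?_) <;> simp [f]
    · rfl
  refine eq_top_iff.2 fun x _ => ?_
  have := DFunLike.congr_fun hf x
  simp only [AlgHom.comp_apply, AlgHom.id_apply] at this
  exact this ▸ (f x).2

/-- The structure map `m` is injective. -/
theorem m_injective : Function.Injective (m k A) := by
  have h₁ : ∀ x y : A, bracket k (bracket k x y) =
      bracket k x ∘ₗ bracket k y - bracket k y ∘ₗ bracket k x := fun x y => by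
    ext c
    have := jacobi (k := k) x y c
    rw [bracket_skew k c (bracket k x y), bracket_skew k c x, map_neg] at this
    simp only [LinearMap.sub_apply, LinearMap.comp_apply]
    linear_combination -this
  let f : PoissonEnv k A →ₐ[k] Module.End k A :=
    lift (Algebra.lmul k A) (bracket k) h₁
      (fun x y => by ext c; simp [bracket_mul_left]; ring)
      (fun x y => by ext c; simp [leibniz])
  intro x y hxy
  have := congr(f $hxy 1)
  simpa [f] using this

end Algebra

section RingIdentities

variable {R : Type*} [Ring R] {m₁ m₂ s₁ s₂ h₁ h₂ : R}

theorem ring_aux_mul (a₁ : s₁ * m₁ = 1) (a₂ : s₂ * m₂ = 1) (cs : s₁ * s₂ = s₂ * s₁) :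
    s₁ * s₂ * (m₂ * h₁ + m₁ * h₂) * (s₁ * s₂) =
      s₁ * h₁ * s₁ * s₂ + s₂ * h₂ * s₂ * s₁ := by
  have e₁ : s₁ * s₂ * m₂ = s₁ := by rw [mul_assoc, a₂, mul_one]
  have e₂ : s₁ * s₂ * m₁ = s₂ := by rw [cs, mul_assoc, a₁, mul_one]
  calc s₁ * s₂ * (m₂ * h₁ + m₁ * h₂) * (s₁ * s₂)
      = s₁ * s₂ * m₂ * h₁ * (s₁ * s₂) + s₁ * s₂ * m₁ * h₂ * (s₁ * s₂) := by noncomm_ring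
    _ = s₁ * h₁ * (s₁ * s₂) + s₂ * h₂ * (s₂ * s₁) := by rw [e₁, e₂, cs]
    _ = _ := by simp only [mul_assoc]

theorem ring_aux_comm (a₂ : s₂ * m₂ = 1) (b₂ : m₂ * s₂ = 1) (cs : s₁ * s₂ = s₂ * s₁) :
    s₁ * s₂ * (h₁ * m₂ - m₂ * h₁) * (s₁ * s₂) =
      s₂ * (s₁ * h₁ * s₁) - s₁ * h₁ * s₁ * s₂ := by
  have e₁ : s₁ * s₂ * m₂ = s₁ := by rw [mul_assoc, a₂, mul_one]
  have e₂ : m₂ * (s₁ * s₂) = s₁ := by rw [cs, ← mul_assoc, b₂, one_mul]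
  calc s₁ * s₂ * (h₁ * m₂ - m₂ * h₁) * (s₁ * s₂)
      = s₁ * s₂ * h₁ * (m₂ * (s₁ * s₂)) - s₁ * s₂ * m₂ * h₁ * (s₁ * s₂) := by noncomm_ring
    _ = s₂ * s₁ * h₁ * s₁ - s₁ * h₁ * (s₁ * s₂) := by rw [e₁, e₂, cs]
    _ = _ := by simp only [mul_assoc]

theorem ring_aux_bracket {A C P H N : R} (n₁ : s₁ * N = m₂) (n₂ : s₂ * N = m₁)
    (n₃ : N * s₁ = m₂) (n₄ : N * s₂ = m₁)
    (a₁ : s₁ * m₁ = 1) (a₂ : s₂ * m₂ = 1) (b₁ : m₁ * s₁ = 1) (b₂ : m₂ * s₂ = 1)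
    (hP : P = s₂ * A - A * s₂) (hP' : P = C * s₁ - s₁ * C) (hH : H = A * s₂ + C * s₁) :
    P * N * H + H * N * P - (s₂ * A * N * (C * s₁) - s₁ * C * N * (A * s₂)) =
      C * A - A * C := by
  have hH' : H = s₂ * A + s₁ * C := by
    have : A * s₂ + C * s₁ = s₂ * A + s₁ * C + ((C * s₁ - s₁ * C) - (s₂ * A - A * s₂)) := by
      abel
    rw [hH, this, ← hP, ← hP', sub_self, add_zero]
  have t₁ : P * N * H = (C * A - s₁ * C * m₁ * A) + (s₂ * A * m₂ * C - A * C) := by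
    calc P * N * H = P * (N * s₂) * A + P * (N * s₁) * C := by rw [hH']; noncomm_ring
      _ = (C * s₁ - s₁ * C) * m₁ * A + (s₂ * A - A * s₂) * m₂ * C := by
          rw [n₃, n₄, ← hP, ← hP']
      _ = (C * (s₁ * m₁) * A - s₁ * C * m₁ * A) + (s₂ * A * m₂ * C - A * (s₂ * m₂) * C) := by
          noncomm_ring
      _ = _ := by rw [a₁, a₂, mul_one, mul_one]
  have u₁ : A * m₁ * P = A * m₁ * C * s₁ - A * C := by
    calc A * m₁ * P = A * m₁ * C * s₁ - A * (m₁ * s₁) * C := by rw [hP']; noncomm_ring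
      _ = _ := by rw [b₁, mul_one]
  have u₂ : C * m₂ * P = C * A - C * m₂ * A * s₂ := by
    calc C * m₂ * P = C * (m₂ * s₂) * A - C * m₂ * A * s₂ := by rw [hP]; noncomm_ring
      _ = _ := by rw [b₂, mul_one]
  have u₃ : s₂ * A * N * P = s₂ * A * N * (C * s₁) - s₂ * A * m₂ * C := by
    calc s₂ * A * N * P = s₂ * A * N * (C * s₁) - s₂ * A * (N * s₁) * C := by
          rw [hP']; noncomm_ring
      _ = _ := by rw [n₃]
  have u₄ : s₁ * C * N * P = s₁ * C * m₁ * A - s₁ * C * N * (A * s₂) := by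
    calc s₁ * C * N * P = s₁ * C * (N * s₂) * A - s₁ * C * N * (A * s₂) := by
          rw [hP]; noncomm_ring
      _ = _ := by rw [n₄]
  have t₂ : H * N * P = A * m₁ * P + C * m₂ * P := by
    calc H * N * P = A * (s₂ * N) * P + C * (s₁ * N) * P := by rw [hH]; noncomm_ring
      _ = _ := by rw [n₁, n₂]
  have t₃ : A * m₁ * P - s₂ * A * N * P + C * m₂ * P - s₁ * C * N * P = 0 := by
    calc A * m₁ * P - s₂ * A * N * P + C * m₂ * P - s₁ * C * N * P
        = A * (s₂ * N) * P - s₂ * A * N * P + C * (s₁ * N) * P - s₁ * C * N * P := by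
          rw [n₁, n₂]
      _ = ((C * s₁ - s₁ * C) - (s₂ * A - A * s₂)) * N * P := by noncomm_ring
      _ = 0 := by rw [← hP, ← hP', sub_self, zero_mul, zero_mul]
  rw [← sub_eq_zero, ← t₃, t₁, t₂, u₁, u₂, u₃, u₄]
  abel

end RingIdentities

section Bialgebra

variable (k : Type*) (B : Type*) [Field k] [CommRing B] [Bialgebra k B] [PoissonAlgebra k B]

/-- The algebra map `m ⊗ m : B ⊗ B → B^e ⊗ B^e`. -/
def mm : B ⊗[k] B →ₐ[k] (PoissonEnv k B) ⊗[k] (PoissonEnv k B) := Algebra.TensorProduct.map (m k B) (m k B)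

/-- The linear map `m ⊗ h + h ⊗ m : B ⊗ B → B^e ⊗ B^e`. -/
def mh : B ⊗[k] B →ₗ[k] (PoissonEnv k B) ⊗[k] (PoissonEnv k B) :=
  TensorProduct.map (m k B).toLinearMap (h k B) + TensorProduct.map (h k B) (m k B).toLinearMap

@[simp]
theorem mm_tmul (a b : B) : mm k B (a ⊗ₜ b) = m k B a ⊗ₜ m k B b := rfl

@[simp]
theorem mh_tmul (a b : B) :
    mh k B (a ⊗ₜ b) = m k B a ⊗ₜ h k B b + h k B a ⊗ₜ m k B b := rfl

theorem h_mul_m (x y : B) : h k B x * m k B y = m k B y * h k B x + m k B (bracket k x y) := by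
  rw [m_bracket]; abel

theorem mh_bracket (u v : B ⊗[k] B) :
    mh k B (tensorBracket k B u v) = mh k B u * mh k B v - mh k B v * mh k B u := by
  induction u with
  | zero => simp
  | add u u' hu hu' => simp only [map_add, LinearMap.add_apply, hu, hu', add_mul, mul_add]; abel
  | tmul a b =>
    induction v with
    | zero => simp
    | add v v' hv hv' => simp only [map_add, hv, hv', add_mul, mul_add]; abel
    | tmul c d =>
      have e₁ : m k B c * m k B a = m k B a * m k B c := by rw [← map_mul, mul_comm, map_mul]
      have e₂ : m k B d * m k B b = m k B b * m k B d := by rw [← map_mul, mul_comm, map_mul]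
      simp only [tensorBracket_tmul, map_add, mh_tmul, add_mul, mul_add,
        Algebra.TensorProduct.tmul_mul_tmul, h_mul_m, h_bracket, h_mul, map_mul,
        TensorProduct.tmul_add, TensorProduct.add_tmul, TensorProduct.tmul_sub,
        TensorProduct.sub_tmul, e₁, e₂, bracket_skew k c a, bracket_skew k d b, map_neg,
        TensorProduct.tmul_neg, TensorProduct.neg_tmul]
      abel

theorem mh_mul (u v : B ⊗[k] B) :
    mh k B (u * v) = mm k B v * mh k B u + mm k B u * mh k B v := by
  induction u with
  | zero => simp
  | add u u' hu hu' => simp only [map_add, hu, hu', add_mul, mul_add]; abel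
  | tmul a b =>
    induction v with
    | zero => simp
    | add v v' hv hv' => simp only [map_add, hv, hv', add_mul, mul_add]; abel
    | tmul c d =>
      have e₁ : m k B c * m k B a = m k B a * m k B c := by rw [← map_mul, mul_comm, map_mul]
      have e₂ : m k B d * m k B b = m k B b * m k B d := by rw [← map_mul, mul_comm, map_mul]
      simp only [mh_tmul, mm_tmul, mul_add, Algebra.TensorProduct.tmul_mul_tmul, h_mul, map_mul,
        TensorProduct.tmul_add, TensorProduct.add_tmul, e₁, e₂]
      abel

theorem mm_bracket (u v : B ⊗[k] B) :
    mm k B (tensorBracket k B u v) = mh k B u * mm k B v - mm k B v * mh k B u := by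
  induction u with
  | zero => simp
  | add u u' hu hu' => simp only [map_add, LinearMap.add_apply, hu, hu', add_mul, mul_add]; abel
  | tmul a b =>
    induction v with
    | zero => simp
    | add v v' hv hv' => simp only [map_add, hv, hv', add_mul, mul_add]; abel
    | tmul c d =>
      have e₁ : m k B c * m k B a = m k B a * m k B c := by rw [← map_mul, mul_comm, map_mul]
      have e₂ : m k B d * m k B b = m k B b * m k B d := by rw [← map_mul, mul_comm, map_mul]
      simp only [tensorBracket_tmul, map_add, mh_tmul, mm_tmul, add_mul, mul_add,
        Algebra.TensorProduct.tmul_mul_tmul, h_mul_m, map_mul,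
        TensorProduct.tmul_add, TensorProduct.add_tmul, e₁, e₂]
      abel

variable [IsPoissonBialgebra k B]

variable {B} in
theorem counit_bracket (a b : B) : Coalgebra.counit (R := k) (bracket k a b) = 0 := by
  let ε : B →ₗ[k] k := Coalgebra.counit
  let F : B ⊗[k] B →ₗ[k] k := LinearMap.mul' k k ∘ₗ TensorProduct.map ε ε
  let l : B ⊗[k] B →ₗ[k] B := (TensorProduct.lid k B).toLinearMap ∘ₗ ε.rTensor B
  let r : B ⊗[k] B →ₗ[k] B := (TensorProduct.rid k B).toLinearMap ∘ₗ ε.lTensor B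
  have hl : ∀ x : B, l (Coalgebra.comul x) = x := fun x => by simp [l, ε]
  have hr : ∀ x : B, r (Coalgebra.comul x) = x := fun x => by simp [r, ε]
  have hF : ∀ x : B, F (Coalgebra.comul x) = ε x := fun x => by
    conv_rhs => rw [← hl x]
    generalize Coalgebra.comul (R := k) x = u
    induction u with
    | zero => simp
    | add u v hu hv => simp only [map_add, hu, hv]
    | tmul a b => simp [F, l]
  have key : ∀ u v : B ⊗[k] B, F (tensorBracket k B u v) =
      ε (bracket k (l u) (l v)) + ε (bracket k (r u) (r v)) := by
    intro u v
    induction u with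
    | zero => simp
    | add u u' hu hu' => simp only [map_add, LinearMap.add_apply, hu, hu']; abel
    | tmul a b =>
      induction v with
      | zero => simp
      | add v v' hv hv' => simp only [map_add, hv, hv']; abel
      | tmul c d => simp [F, l, r, ε]; ring
  have h := key (Coalgebra.comul a) (Coalgebra.comul b)
  rw [← IsPoissonBialgebra.comul_bracket, hF, hl, hl, hr, hr] at h
  exact left_eq_add.1 h

/-- The comultiplication of `B^e`: `Δ m = (m ⊗ m) Δ` and `Δ h = (m ⊗ h + h ⊗ m) Δ`. -/
def comulHom : (PoissonEnv k B) →ₐ[k] (PoissonEnv k B) ⊗[k] (PoissonEnv k B) :=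
  lift ((mm k B).comp (Bialgebra.comulAlgHom k B)) (mh k B ∘ₗ Coalgebra.comul)
    (fun x y => by simp [IsPoissonBialgebra.comul_bracket, mh_bracket])
    (fun x y => by simp [mh_mul])
    (fun x y => by simp [IsPoissonBialgebra.comul_bracket, mm_bracket])

/-- The counit of `B^e`: `ε m = ε` and `ε h = 0`. -/
def counitHom : (PoissonEnv k B) →ₐ[k] k :=
  lift (Bialgebra.counitAlgHom k B) 0 (fun x y => by simp) (fun x y => by simp)
    (fun x y => by simp [counit_bracket])

@[simp]
theorem comulHom_m (x : B) : comulHom k B (m k B x) = mm k B (Coalgebra.comul x) := by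
  simp [comulHom]

@[simp]
theorem comulHom_h (x : B) : comulHom k B (h k B x) = mh k B (Coalgebra.comul x) := by
  simp [comulHom]

@[simp]
theorem counitHom_m (x : B) : counitHom k B (m k B x) = Coalgebra.counit (R := k) x := by
  simp [counitHom]

@[simp]
theorem counitHom_h (x : B) : counitHom k B (h k B x) = 0 := by
  simp [counitHom]

instance : Bialgebra k (PoissonEnv k B) :=
  Bialgebra.ofAlgHom (comulHom k B) (counitHom k B)
    (by
      have hm (u : B ⊗[k] B) : Algebra.TensorProduct.map (comulHom k B) (.id k (PoissonEnv k B)) (mm k B u) =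
          TensorProduct.map (mm k B).toLinearMap (m k B).toLinearMap
            (Coalgebra.comul.rTensor B u) := by
        induction u with
        | zero => simp
        | add u v hu hv => simp only [map_add, hu, hv]
        | tmul a b => simp
      have hm' (u : B ⊗[k] B) : Algebra.TensorProduct.map (.id k (PoissonEnv k B)) (comulHom k B) (mm k B u) =
          TensorProduct.map (m k B).toLinearMap (mm k B).toLinearMap
            (Coalgebra.comul.lTensor B u) := by
        induction u with
        | zero => simp
        | add u v hu hv => simp only [map_add, hu, hv]
        | tmul a b => simp
      have hh (u : B ⊗[k] B) : Algebra.TensorProduct.map (comulHom k B) (.id k (PoissonEnv k B)) (mh k B u) =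
          (TensorProduct.map (mm k B).toLinearMap (h k B) +
            TensorProduct.map (mh k B) (m k B).toLinearMap) (Coalgebra.comul.rTensor B u) := by
        induction u with
        | zero => simp
        | add u v hu hv => simp only [map_add, hu, hv]
        | tmul a b => simp
      have hh' (u : B ⊗[k] B) : Algebra.TensorProduct.map (.id k (PoissonEnv k B)) (comulHom k B) (mh k B u) =
          (TensorProduct.map (m k B).toLinearMap (mh k B) +
            TensorProduct.map (h k B) (mm k B).toLinearMap) (Coalgebra.comul.lTensor B u) := by
        induction u with
        | zero => simp
        | add u v hu hv => simp only [map_add, hu, hv]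
        | tmul a b => simp
      have am : (TensorProduct.assoc k (PoissonEnv k B) (PoissonEnv k B) (PoissonEnv k B)).toLinearMap ∘ₗ
          TensorProduct.map (mm k B).toLinearMap (m k B).toLinearMap =
          TensorProduct.map (m k B).toLinearMap (mm k B).toLinearMap ∘ₗ
            (TensorProduct.assoc k B B B).toLinearMap :=
        TensorProduct.ext_threefold fun a b c => by simp
      have ah : (TensorProduct.assoc k (PoissonEnv k B) (PoissonEnv k B) (PoissonEnv k B)).toLinearMap ∘ₗ
          (TensorProduct.map (mm k B).toLinearMap (h k B) +
            TensorProduct.map (mh k B) (m k B).toLinearMap) =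
          (TensorProduct.map (m k B).toLinearMap (mh k B) +
            TensorProduct.map (h k B) (mm k B).toLinearMap) ∘ₗ
            (TensorProduct.assoc k B B B).toLinearMap :=
        TensorProduct.ext_threefold fun a b c => by
          simp [TensorProduct.add_tmul, TensorProduct.tmul_add, add_assoc]
      refine algHom_ext (fun x => ?_) (fun x => ?_)
      · have := congr($am (Coalgebra.comul.rTensor B (Coalgebra.comul x)))
        simp only [LinearMap.comp_apply, LinearEquiv.coe_coe, Coalgebra.coassoc_apply] at this
        simp only [AlgHom.comp_apply, comulHom_m, hm, hm']
        exact this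
      · have := congr($ah (Coalgebra.comul.rTensor B (Coalgebra.comul x)))
        simp only [LinearMap.comp_apply, LinearEquiv.coe_coe, Coalgebra.coassoc_apply] at this
        simp only [AlgHom.comp_apply, comulHom_h, hh, hh']
        exact this)
    (by
      have hm (u : B ⊗[k] B) : Algebra.TensorProduct.map (counitHom k B) (.id k (PoissonEnv k B)) (mm k B u) =
          (m k B).toLinearMap.lTensor k (Coalgebra.counit.rTensor B u) := by
        induction u with
        | zero => simp
        | add u v hu hv => simp only [map_add, hu, hv]
        | tmul a b => simp
      have hh (u : B ⊗[k] B) : Algebra.TensorProduct.map (counitHom k B) (.id k (PoissonEnv k B)) (mh k B u) =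
          (h k B).lTensor k (Coalgebra.counit.rTensor B u) := by
        induction u with
        | zero => simp
        | add u v hu hv => simp only [map_add, hu, hv]
        | tmul a b => simp
      refine algHom_ext (fun x => ?_) (fun x => ?_)
      · simp [hm]
      · simp [hh])
    (by
      have hm (u : B ⊗[k] B) : Algebra.TensorProduct.map (.id k (PoissonEnv k B)) (counitHom k B) (mm k B u) =
          (m k B).toLinearMap.rTensor k (Coalgebra.counit.lTensor B u) := by
        induction u with
        | zero => simp
        | add u v hu hv => simp only [map_add, hu, hv]
        | tmul a b => simp
      have hh (u : B ⊗[k] B) : Algebra.TensorProduct.map (.id k (PoissonEnv k B)) (counitHom k B) (mh k B u) =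
          (h k B).rTensor k (Coalgebra.counit.lTensor B u) := by
        induction u with
        | zero => simp
        | add u v hu hv => simp only [map_add, hu, hv]
        | tmul a b => simp
      refine algHom_ext (fun x => ?_) (fun x => ?_)
      · simp [hm]
      · simp [hh])

@[simp]
theorem comul_m (x : B) : Coalgebra.comul (R := k) (m k B x) =
    TensorProduct.map (m k B).toLinearMap (m k B).toLinearMap (Coalgebra.comul x) :=
  comulHom_m k B x

@[simp]
theorem comul_h (x : B) : Coalgebra.comul (R := k) (h k B x) =
    (TensorProduct.map (m k B).toLinearMap (h k B) +
      TensorProduct.map (h k B) (m k B).toLinearMap) (Coalgebra.comul x) :=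
  comulHom_h k B x

@[simp]
theorem counit_m (x : B) : Coalgebra.counit (R := k) (m k B x) = Coalgebra.counit (R := k) x :=
  counitHom_m k B x

@[simp]
theorem counit_h (x : B) : Coalgebra.counit (R := k) (h k B x) = 0 :=
  counitHom_h k B x

end Bialgebra

section Hopf

open WithConv

variable (k : Type*) (B : Type*) [Field k] [CommRing B] [HopfAlgebra k B] [PoissonAlgebra k B]

/-- The coalgebra map `id ⊗ ε : B ⊗ B → B`. -/
def pr₁ : B ⊗[k] B →ₗc[k] B :=
  (Coalgebra.TensorProduct.rid k k B).toCoalgHom.comp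
    (Coalgebra.TensorProduct.map (.id k B) (Coalgebra.counitCoalgHom k B))

/-- The coalgebra map `ε ⊗ id : B ⊗ B → B`. -/
def pr₂ : B ⊗[k] B →ₗc[k] B :=
  (Coalgebra.TensorProduct.lid k B).toCoalgHom.comp
    (Coalgebra.TensorProduct.map (Coalgebra.counitCoalgHom k B) (.id k B))

@[simp]
theorem pr₁_tmul (a b : B) : pr₁ k B (a ⊗ₜ b) = Coalgebra.counit (R := k) b • a := rfl

@[simp]
theorem pr₂_tmul (a b : B) : pr₂ k B (a ⊗ₜ b) = Coalgebra.counit (R := k) a • b := rfl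

variable {k B}

/-- Composition with a coalgebra map is a ring map of convolution algebras. -/
def pull (φ : B ⊗[k] B →ₗc[k] B) :
    WithConv (B →ₗ[k] (PoissonEnv k B)) →+* WithConv (B ⊗[k] B →ₗ[k] (PoissonEnv k B)) where
  toFun f := toConv (f.ofConv ∘ₗ φ.toLinearMap)
  map_one' := by ext; simp
  map_mul' f g := by
    apply ofConv_injective
    exact LinearMap.convMul_comp_coalgHom_distrib f g φ
  map_zero' := by ext; simp
  map_add' f g := by ext; simp

@[simp]
theorem pull_apply (φ : B ⊗[k] B →ₗc[k] B) (f : WithConv (B →ₗ[k] (PoissonEnv k B))) (x : B ⊗[k] B) :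
    pull φ f x = f (φ x) := rfl

/-- Composition with `id ⊗ ε`. -/
abbrev pull₁ : WithConv (B →ₗ[k] (PoissonEnv k B)) →+* WithConv (B ⊗[k] B →ₗ[k] (PoissonEnv k B)) := pull (pr₁ k B)

/-- Composition with `ε ⊗ id`. -/
abbrev pull₂ : WithConv (B →ₗ[k] (PoissonEnv k B)) →+* WithConv (B ⊗[k] B →ₗ[k] (PoissonEnv k B)) := pull (pr₂ k B)

theorem pull₁_mul_pull₂ (f g : WithConv (B →ₗ[k] (PoissonEnv k B))) (a b : B) :
    (pull₁ f * pull₂ g) (a ⊗ₜ b) = f a * g b := by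
  have key : ∀ u v : B ⊗[k] B,
      LinearMap.mul' k (PoissonEnv k B) (TensorProduct.map (pull₁ f).ofConv (pull₂ g).ofConv
        (TensorProduct.tensorTensorTensorComm k B B B B (u ⊗ₜ v))) =
      f (TensorProduct.rid k B (Coalgebra.counit.lTensor B u)) *
        g (TensorProduct.lid k B (Coalgebra.counit.rTensor B v)) := by
    intro u v
    induction u with
    | zero => simp
    | add u u' hu hu' => simp only [map_add, TensorProduct.add_tmul, hu, hu', add_mul]
    | tmul a b =>
      induction v with
      | zero => simp
      | add v v' hv hv' => simp only [map_add, TensorProduct.tmul_add, hv, hv', mul_add]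
      | tmul c d =>
        change f (Coalgebra.counit (R := k) c • a) * g (Coalgebra.counit (R := k) b • d) = _
        simp [smul_smul, mul_comm]
  refine (key (Coalgebra.comul (R := k) a) (Coalgebra.comul (R := k) b)).trans ?_
  simp

theorem pull₂_mul_pull₁ (f g : WithConv (B →ₗ[k] (PoissonEnv k B))) (a b : B) :
    (pull₂ g * pull₁ f) (a ⊗ₜ b) = g b * f a := by
  have key : ∀ u v : B ⊗[k] B,
      LinearMap.mul' k (PoissonEnv k B) (TensorProduct.map (pull₂ g).ofConv (pull₁ f).ofConv
        (TensorProduct.tensorTensorTensorComm k B B B B (u ⊗ₜ v))) =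
      g (TensorProduct.rid k B (Coalgebra.counit.lTensor B v)) *
        f (TensorProduct.lid k B (Coalgebra.counit.rTensor B u)) := by
    intro u v
    induction u with
    | zero => simp
    | add u u' hu hu' => simp only [map_add, TensorProduct.add_tmul, hu, hu', mul_add]
    | tmul a b =>
      induction v with
      | zero => simp
      | add v v' hv hv' => simp only [map_add, TensorProduct.tmul_add, hv, hv', add_mul]
      | tmul c d =>
        change g (Coalgebra.counit (R := k) a • c) * f (Coalgebra.counit (R := k) d • b) = _
        simp [smul_smul, mul_comm]
  refine (key (Coalgebra.comul (R := k) a) (Coalgebra.comul (R := k) b)).trans ?_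
  simp

/-- Composition with the bracket `B ⊗ B → B`. -/
def pullBracket (f : WithConv (B →ₗ[k] (PoissonEnv k B))) : WithConv (B ⊗[k] B →ₗ[k] (PoissonEnv k B)) :=
  toConv (f.ofConv ∘ₗ TensorProduct.lift (bracket k))

@[simp]
theorem pullBracket_tmul (f : WithConv (B →ₗ[k] (PoissonEnv k B))) (a b : B) :
    pullBracket f (a ⊗ₜ b) = f (bracket k a b) := rfl

/-- Composition with the multiplication `B ⊗ B → B`. -/
abbrev pullMul : WithConv (B →ₗ[k] (PoissonEnv k B)) →+* WithConv (B ⊗[k] B →ₗ[k] (PoissonEnv k B)) :=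
  pull (Bialgebra.mulCoalgHom k B)

@[simp]
theorem pullMul_tmul (f : WithConv (B →ₗ[k] (PoissonEnv k B))) (a b : B) :
    pullMul f (a ⊗ₜ b) = f (a * b) := rfl

variable [IsPoissonBialgebra k B]

theorem pullBracket_mul (f g : WithConv (B →ₗ[k] (PoissonEnv k B))) :
    pullBracket (f * g) = pullMul f * pullBracket g + pullBracket f * pullMul g := by
  have key : ∀ u v : B ⊗[k] B,
      LinearMap.mul' k (PoissonEnv k B) (TensorProduct.map f.ofConv g.ofConv (tensorBracket k B u v)) =
      LinearMap.mul' k (PoissonEnv k B) (TensorProduct.map (pullMul f).ofConv (pullBracket g).ofConv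
        (TensorProduct.tensorTensorTensorComm k B B B B (u ⊗ₜ v))) +
      LinearMap.mul' k (PoissonEnv k B) (TensorProduct.map (pullBracket f).ofConv (pullMul g).ofConv
        (TensorProduct.tensorTensorTensorComm k B B B B (u ⊗ₜ v))) := by
    intro u v
    induction u with
    | zero => simp
    | add u u' hu hu' =>
      simp only [map_add, LinearMap.add_apply, TensorProduct.add_tmul, hu, hu']; abel
    | tmul a b =>
      induction v with
      | zero => simp
      | add v v' hv hv' => simp only [map_add, TensorProduct.tmul_add, hv, hv']; abel
      | tmul c d =>
        rw [tensorBracket_tmul, map_add, map_add]; rfl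
  apply ofConv_injective
  refine TensorProduct.ext' fun a b => ?_
  refine Eq.trans ?_ (key (Coalgebra.comul (R := k) a) (Coalgebra.comul (R := k) b))
  rw [← IsPoissonBialgebra.comul_bracket]; rfl

theorem pullBracket_one : pullBracket (1 : WithConv (B →ₗ[k] (PoissonEnv k B))) = 0 := by
  apply ofConv_injective
  refine TensorProduct.ext' fun a b => ?_
  change algebraMap k (PoissonEnv k B) (Coalgebra.counit (R := k) (bracket k a b)) = 0
  rw [counit_bracket, map_zero]

variable (k B)

/-- The structure map `m` in the convolution algebra. -/
def cm : WithConv (B →ₗ[k] (PoissonEnv k B)) := toConv (m k B).toLinearMap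

/-- The structure map `h` in the convolution algebra. -/
def ch : WithConv (B →ₗ[k] (PoissonEnv k B)) := toConv (h k B)

/-- The convolution inverse `m S` of `m`. -/
def cs : WithConv (B →ₗ[k] (PoissonEnv k B)) := toConv ((m k B).toLinearMap ∘ₗ HopfAlgebra.antipode k)

/-- The antipode of `B^e` on the elements `h_b`: minus the convolution product
`(m S) * h * (m S)`, that is, `S h_b = - m_{S b₁} h_{b₂} m_{S b₃}`. -/
def ct : WithConv (B →ₗ[k] (PoissonEnv k B)) := -(cs k B * ch k B * cs k B)

theorem cs_mul_cm : cs k B * cm k B = 1 := by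
  have := LinearMap.algHom_comp_convMul_distrib (m k B)
    (toConv (HopfAlgebra.antipode k (A := B))) (toConv LinearMap.id)
  rw [LinearMap.antipode_mul_id] at this
  refine ofConv_injective (this.symm.trans ?_)
  ext; simp

theorem cm_mul_cs : cm k B * cs k B = 1 := by
  have := LinearMap.algHom_comp_convMul_distrib (m k B)
    (toConv LinearMap.id) (toConv (HopfAlgebra.antipode k (A := B)))
  rw [LinearMap.id_mul_antipode] at this
  refine ofConv_injective (this.symm.trans ?_)
  ext; simp

theorem cm_mul_ct : cm k B * ct k B = -(ch k B * cs k B) := by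
  rw [ct, mul_neg, mul_assoc, ← mul_assoc, cm_mul_cs, one_mul]

theorem ct_mul_cm : ct k B * cm k B = -(cs k B * ch k B) := by
  rw [ct, neg_mul, mul_assoc, cs_mul_cm, mul_one]

theorem m_comm (x y : B) : m k B x * m k B y = m k B y * m k B x := by
  rw [← map_mul, mul_comm, map_mul]

variable {k B} in
theorem conv_ext {f g : WithConv (B ⊗[k] B →ₗ[k] (PoissonEnv k B))} (H : ∀ a b, f (a ⊗ₜ b) = g (a ⊗ₜ b)) :
    f = g :=
  ofConv_injective (TensorProduct.ext' H)

theorem m₁_mul_m₂ : pull₁ (cm k B) * pull₂ (cm k B) = pullMul (cm k B) := conv_ext fun a b => by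
  rw [pull₁_mul_pull₂]; exact (map_mul (m k B) a b).symm

theorem m₂_mul_m₁ : pull₂ (cm k B) * pull₁ (cm k B) = pullMul (cm k B) := conv_ext fun a b => by
  rw [pull₂_mul_pull₁, pullMul_tmul, mul_comm a]; exact (map_mul (m k B) b a).symm

theorem s₁_mul_s₂ : pull₁ (cs k B) * pull₂ (cs k B) = pullMul (cs k B) := conv_ext fun a b => by
  rw [pull₁_mul_pull₂, pullMul_tmul]
  change m k B _ * m k B _ = m k B _
  rw [HopfAlgebra.antipode_mul_distrib, map_mul]

theorem s₂_mul_s₁ : pull₂ (cs k B) * pull₁ (cs k B) = pullMul (cs k B) := conv_ext fun a b => by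
  rw [pull₂_mul_pull₁, pullMul_tmul]
  change m k B _ * m k B _ = m k B _
  rw [HopfAlgebra.antipode_mul_antidistrib, map_mul]

theorem pullMul_ch : pullMul (ch k B) = pull₂ (cm k B) * pull₁ (ch k B) + pull₁ (cm k B) * pull₂ (ch k B) := conv_ext fun a b => by
  refine (h_mul k a b).trans ?_
  exact congrArg₂ (· + ·) (pull₂_mul_pull₁ (ch k B) (cm k B) a b).symm
    (pull₁_mul_pull₂ (cm k B) (ch k B) a b).symm

theorem pullBracket_cm : pullBracket (cm k B) = pull₁ (ch k B) * pull₂ (cm k B) - pull₂ (cm k B) * pull₁ (ch k B) := conv_ext fun a b => by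
  refine (m_bracket k a b).trans ?_
  exact congrArg₂ (· - ·) (pull₁_mul_pull₂ (ch k B) (cm k B) a b).symm
    (pull₂_mul_pull₁ (ch k B) (cm k B) a b).symm

theorem pullBracket_cm' : pullBracket (cm k B) = pull₁ (cm k B) * pull₂ (ch k B) - pull₂ (ch k B) * pull₁ (cm k B) := conv_ext fun a b => by
  rw [pullBracket_tmul, bracket_skew]
  change m k B (-_) = _
  rw [map_neg, m_bracket, neg_sub]
  exact congrArg₂ (· - ·) (pull₁_mul_pull₂ (cm k B) (ch k B) a b).symm
    (pull₂_mul_pull₁ (cm k B) (ch k B) a b).symm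

theorem pullBracket_ch : pullBracket (ch k B) = pull₁ (ch k B) * pull₂ (ch k B) - pull₂ (ch k B) * pull₁ (ch k B) := conv_ext fun a b => by
  refine (h_bracket k a b).trans ?_
  exact congrArg₂ (· - ·) (pull₁_mul_pull₂ (ch k B) (ch k B) a b).symm
    (pull₂_mul_pull₁ (ch k B) (ch k B) a b).symm

theorem s₁_mul_m₁ : pull₁ (cs k B) * pull₁ (cm k B) = 1 := by rw [← map_mul, cs_mul_cm, map_one]
theorem s₂_mul_m₂ : pull₂ (cs k B) * pull₂ (cm k B) = 1 := by rw [← map_mul, cs_mul_cm, map_one]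
theorem m₁_mul_s₁ : pull₁ (cm k B) * pull₁ (cs k B) = 1 := by rw [← map_mul, cm_mul_cs, map_one]
theorem m₂_mul_s₂ : pull₂ (cm k B) * pull₂ (cs k B) = 1 := by rw [← map_mul, cm_mul_cs, map_one]

theorem t₁_eq : pull₁ (ct k B) = -(pull₁ (cs k B) * pull₁ (ch k B) * pull₁ (cs k B)) := by rw [ct, map_neg, map_mul, map_mul]
theorem t₂_eq : pull₂ (ct k B) = -(pull₂ (cs k B) * pull₂ (ch k B) * pull₂ (cs k B)) := by rw [ct, map_neg, map_mul, map_mul]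

theorem pullMul_ct' : pullMul (ct k B) =
    -(pull₁ (cs k B) * pull₂ (cs k B) * (pull₂ (cm k B) * pull₁ (ch k B) + pull₁ (cm k B) * pull₂ (ch k B)) * (pull₁ (cs k B) * pull₂ (cs k B))) := by
  rw [ct, map_neg, map_mul, map_mul, pullMul_ch, s₁_mul_s₂]

theorem pullMul_ct : pullMul (ct k B) = pull₁ (ct k B) * pull₂ (cs k B) + pull₂ (ct k B) * pull₁ (cs k B) := by
  rw [pullMul_ct', ring_aux_mul (s₁_mul_m₁ k B) (s₂_mul_m₂ k B)
    ((s₁_mul_s₂ k B).trans (s₂_mul_s₁ k B).symm), t₁_eq, t₂_eq]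
  noncomm_ring

theorem pullMul_cs_mul_cm : pullMul (cs k B) * pullMul (cm k B) = 1 := by
  rw [← map_mul, cs_mul_cm, map_one]

theorem pullBracket_cs' : pullBracket (cs k B) =
    -(pull₁ (cs k B) * pull₂ (cs k B) * pullBracket (cm k B) * (pull₁ (cs k B) * pull₂ (cs k B))) := by
  have := pullBracket_mul (cm k B) (cs k B)
  rw [cm_mul_cs, pullBracket_one] at this
  have := congrArg (pullMul (cs k B) * ·) this
  simp only [mul_zero, mul_add, ← mul_assoc, pullMul_cs_mul_cm, one_mul] at this
  rw [s₁_mul_s₂]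
  exact eq_neg_of_add_eq_zero_left this.symm

theorem pullBracket_cs : pullBracket (cs k B) = pull₂ (cs k B) * pull₁ (ct k B) - pull₁ (ct k B) * pull₂ (cs k B) := by
  rw [pullBracket_cs', pullBracket_cm, ring_aux_comm (s₂_mul_m₂ k B) (m₂_mul_s₂ k B)
    ((s₁_mul_s₂ k B).trans (s₂_mul_s₁ k B).symm), t₁_eq]
  noncomm_ring

theorem pullBracket_neg (f : WithConv (B →ₗ[k] (PoissonEnv k B))) : pullBracket (-f) = -pullBracket f := by
  apply ofConv_injective; exact LinearMap.neg_comp _ _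

theorem pullBracket_ct : pullBracket (ct k B) = pull₂ (ct k B) * pull₁ (ct k B) - pull₁ (ct k B) * pull₂ (ct k B) := by
  have cs' := (s₁_mul_s₂ k B).trans (s₂_mul_s₁ k B).symm
  have cm' := (m₁_mul_m₂ k B).trans (m₂_mul_m₁ k B).symm
  have n₁ : pull₁ (cs k B) * (pull₁ (cm k B) * pull₂ (cm k B)) = pull₂ (cm k B) := by rw [← mul_assoc, s₁_mul_m₁, one_mul]
  have n₂ : pull₂ (cs k B) * (pull₁ (cm k B) * pull₂ (cm k B)) = pull₁ (cm k B) := by rw [cm', ← mul_assoc, s₂_mul_m₂, one_mul]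
  have n₃ : pull₁ (cm k B) * pull₂ (cm k B) * pull₁ (cs k B) = pull₂ (cm k B) := by rw [cm', mul_assoc, m₁_mul_s₁, mul_one]
  have n₄ : pull₁ (cm k B) * pull₂ (cm k B) * pull₂ (cs k B) = pull₁ (cm k B) := by rw [mul_assoc, m₂_mul_s₂, mul_one]
  have hP : pull₁ (cs k B) * pull₂ (cs k B) * pullBracket (cm k B) * (pull₁ (cs k B) * pull₂ (cs k B)) =
      pull₂ (cs k B) * (pull₁ (cs k B) * pull₁ (ch k B) * pull₁ (cs k B)) - pull₁ (cs k B) * pull₁ (ch k B) * pull₁ (cs k B) * pull₂ (cs k B) := by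
    rw [pullBracket_cm, ring_aux_comm (s₂_mul_m₂ k B) (m₂_mul_s₂ k B) cs']
  have hP' : pull₁ (cs k B) * pull₂ (cs k B) * pullBracket (cm k B) * (pull₁ (cs k B) * pull₂ (cs k B)) =
      pull₂ (cs k B) * pull₂ (ch k B) * pull₂ (cs k B) * pull₁ (cs k B) - pull₁ (cs k B) * (pull₂ (cs k B) * pull₂ (ch k B) * pull₂ (cs k B)) := by
    rw [pullBracket_cm', cs', ← neg_sub, mul_neg, neg_mul,
      ring_aux_comm (s₁_mul_m₁ k B) (m₁_mul_s₁ k B) cs'.symm, neg_sub]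
  have hH : pull₁ (cs k B) * pull₂ (cs k B) * (pull₂ (cm k B) * pull₁ (ch k B) + pull₁ (cm k B) * pull₂ (ch k B)) * (pull₁ (cs k B) * pull₂ (cs k B)) =
      pull₁ (cs k B) * pull₁ (ch k B) * pull₁ (cs k B) * pull₂ (cs k B) + pull₂ (cs k B) * pull₂ (ch k B) * pull₂ (cs k B) * pull₁ (cs k B) :=
    ring_aux_mul (s₁_mul_m₁ k B) (s₂_mul_m₂ k B) cs'
  have key := ring_aux_bracket n₁ n₂ n₃ n₄ (s₁_mul_m₁ k B) (s₂_mul_m₂ k B) (m₁_mul_s₁ k B)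
    (m₂_mul_s₂ k B) hP hP' hH
  have hh : pull₂ (cs k B) * (pull₁ (cs k B) * pull₁ (ch k B) * pull₁ (cs k B)) * (pull₁ (cm k B) * pull₂ (cm k B)) * (pull₂ (cs k B) * pull₂ (ch k B) * pull₂ (cs k B) * pull₁ (cs k B)) -
      pull₁ (cs k B) * (pull₂ (cs k B) * pull₂ (ch k B) * pull₂ (cs k B)) * (pull₁ (cm k B) * pull₂ (cm k B)) * (pull₁ (cs k B) * pull₁ (ch k B) * pull₁ (cs k B) * pull₂ (cs k B)) =
      pull₁ (cs k B) * pull₂ (cs k B) * pullBracket (ch k B) * (pull₁ (cs k B) * pull₂ (cs k B)) := by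
    have e₁ : pull₂ (cs k B) * (pull₁ (cs k B) * pull₁ (ch k B) * pull₁ (cs k B)) * (pull₁ (cm k B) * pull₂ (cm k B)) * (pull₂ (cs k B) * pull₂ (ch k B) * pull₂ (cs k B) * pull₁ (cs k B)) =
        pull₂ (cs k B) * pull₁ (cs k B) * pull₁ (ch k B) * (pull₁ (cs k B) * (pull₁ (cm k B) * pull₂ (cm k B))) * pull₂ (cs k B) * pull₂ (ch k B) * (pull₂ (cs k B) * pull₁ (cs k B)) := by noncomm_ring
    have e₂ : pull₁ (cs k B) * (pull₂ (cs k B) * pull₂ (ch k B) * pull₂ (cs k B)) * (pull₁ (cm k B) * pull₂ (cm k B)) * (pull₁ (cs k B) * pull₁ (ch k B) * pull₁ (cs k B) * pull₂ (cs k B)) =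
        pull₁ (cs k B) * pull₂ (cs k B) * pull₂ (ch k B) * (pull₂ (cs k B) * (pull₁ (cm k B) * pull₂ (cm k B))) * pull₁ (cs k B) * pull₁ (ch k B) * (pull₁ (cs k B) * pull₂ (cs k B)) := by noncomm_ring
    rw [e₁, e₂, n₁, n₂, mul_assoc _ (pull₂ (cm k B)), m₂_mul_s₂, mul_one, mul_assoc _ (pull₁ (cm k B)), m₁_mul_s₁, mul_one,
      ← cs', pullBracket_ch]
    noncomm_ring
  rw [hh, m₁_mul_m₂] at key
  have h0 := pullBracket_mul (cm k B) (ct k B)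
  rw [cm_mul_ct, pullBracket_neg, pullBracket_mul, pullBracket_cs', ← s₁_mul_s₂, pullMul_ct',
    pullMul_ch] at h0
  have h1 := congrArg (pullMul (cs k B) * ·) h0
  simp only [mul_add, ← mul_assoc (pullMul (cs k B)) (pullMul (cm k B)), pullMul_cs_mul_cm,
    one_mul] at h1
  have h2 := eq_sub_of_add_eq h1.symm
  rw [h2, t₁_eq, t₂_eq, neg_mul_neg, neg_mul_neg, ← key]
  simp only [← s₁_mul_s₂, ← m₁_mul_m₂]
  have e (X Y : WithConv (B ⊗[k] B →ₗ[k] (PoissonEnv k B))) :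
      pull₁ (cs k B) * pull₂ (cs k B) * X * (pull₁ (cs k B) * pull₂ (cs k B)) * (pull₁ (cm k B) * pull₂ (cm k B)) * (pull₁ (cs k B) * pull₂ (cs k B) * Y * (pull₁ (cs k B) * pull₂ (cs k B))) =
        pull₁ (cs k B) * pull₂ (cs k B) * X * (pull₁ (cs k B) * pull₂ (cs k B)) * Y * (pull₁ (cs k B) * pull₂ (cs k B)) := by
    have : pull₁ (cm k B) * pull₂ (cm k B) * (pull₁ (cs k B) * pull₂ (cs k B)) = 1 := by rw [← mul_assoc, n₃, m₂_mul_s₂]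
    calc _ = pull₁ (cs k B) * pull₂ (cs k B) * X * (pull₁ (cs k B) * pull₂ (cs k B)) * (pull₁ (cm k B) * pull₂ (cm k B) * (pull₁ (cs k B) * pull₂ (cs k B))) * Y * (pull₁ (cs k B) * pull₂ (cs k B)) := by
          simp only [mul_assoc]
      _ = _ := by rw [this, mul_one]
  rw [e, e]
  generalize pullBracket (cm k B) = P
  generalize pullBracket (ch k B) = Q
  noncomm_ring

/-- The antipode of `B^e`, as an algebra map to the opposite algebra. -/
def antipodeHom : (PoissonEnv k B) →ₐ[k] (PoissonEnv k B)ᵐᵒᵖ :=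
  lift
    (AlgHom.ofLinearMap ((MulOpposite.opLinearEquiv k).toLinearMap ∘ₗ (cs k B).ofConv)
      (by simp [cs])
      (fun x y => by
        simp only [cs, ofConv_toConv, LinearMap.comp_apply, AlgHom.toLinearMap_apply,
          LinearEquiv.coe_coe, MulOpposite.coe_opLinearEquiv, ← MulOpposite.op_mul, ← map_mul,
          HopfAlgebra.antipode_mul_antidistrib]))
    ((MulOpposite.opLinearEquiv k).toLinearMap ∘ₗ (ct k B).ofConv)
    (fun x y => by
      have := congr($(pullBracket_ct k B) (x ⊗ₜ y))
      refine congrArg MulOpposite.op (this.trans ?_)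
      exact congrArg₂ (· - ·) (pull₂_mul_pull₁ (ct k B) (ct k B) x y)
        (pull₁_mul_pull₂ (ct k B) (ct k B) x y))
    (fun x y => by
      have := congr($(pullMul_ct k B) (x ⊗ₜ y))
      refine congrArg MulOpposite.op (this.trans ?_)
      exact congrArg₂ (· + ·) (pull₁_mul_pull₂ (ct k B) (cs k B) x y)
        (pull₂_mul_pull₁ (cs k B) (ct k B) x y))
    (fun x y => by
      have := congr($(pullBracket_cs k B) (x ⊗ₜ y))
      refine congrArg MulOpposite.op (this.trans ?_)
      exact congrArg₂ (· - ·) (pull₂_mul_pull₁ (ct k B) (cs k B) x y)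
        (pull₁_mul_pull₂ (ct k B) (cs k B) x y))

/-- The antipode of `B^e`, as a linear map. -/
def antipodeLin : (PoissonEnv k B) →ₗ[k] (PoissonEnv k B) :=
  (MulOpposite.opLinearEquiv k).symm.toLinearMap ∘ₗ (antipodeHom k B).toLinearMap

theorem antipodeLin_mul (x y : (PoissonEnv k B)) :
    antipodeLin k B (x * y) = antipodeLin k B y * antipodeLin k B x := by
  simp [antipodeLin]

theorem antipodeLin_one : antipodeLin k B 1 = 1 := by
  simp [antipodeLin]

@[simp]
theorem antipodeLin_m (x : B) :
    antipodeLin k B (m k B x) = m k B (HopfAlgebra.antipode k x) := by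
  exact congrArg MulOpposite.unop (lift_m _ _ _ _ _ x)

@[simp]
theorem antipodeLin_h (x : B) : antipodeLin k B (h k B x) = ct k B x := by
  exact congrArg MulOpposite.unop (lift_h _ _ _ _ _ x)

theorem antipode_left : LinearMap.mul' k (PoissonEnv k B) ∘ₗ (antipodeLin k B).rTensor (PoissonEnv k B) ∘ₗ Coalgebra.comul =
    Algebra.linearMap k (PoissonEnv k B) ∘ₗ Coalgebra.counit := by
  let F : (PoissonEnv k B) ⊗[k] (PoissonEnv k B) →ₗ[k] (PoissonEnv k B) := LinearMap.mul' k (PoissonEnv k B) ∘ₗ (antipodeLin k B).rTensor (PoissonEnv k B)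
  have hF₁ (u : (PoissonEnv k B) ⊗[k] (PoissonEnv k B)) (c d : (PoissonEnv k B)) : F (u * c ⊗ₜ d) = antipodeLin k B c * F u * d := by
    induction u with
    | zero => simp
    | add u v hu hv => simp only [add_mul, mul_add, map_add, hu, hv]
    | tmul a b => simp [F, antipodeLin_mul, mul_assoc]
  have hF₂ (u v : (PoissonEnv k B) ⊗[k] (PoissonEnv k B)) (r : k) (hu : F u = algebraMap k (PoissonEnv k B) r) : F (u * v) = r • F v := by
    induction v with
    | zero => simp
    | add v w hv hw => simp only [mul_add, map_add, smul_add, hv, hw]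
    | tmul a b => rw [hF₁, hu, ← Algebra.commutes, ← Algebra.smul_def]; simp [F]
  have hF₃ (x : (PoissonEnv k B)) : F (Coalgebra.comul x) = algebraMap k (PoissonEnv k B) (Coalgebra.counit x) := by
    have hx : x ∈ Algebra.adjoin k (Set.range (m k B) ∪ Set.range (h k B)) := by
      rw [adjoin_eq_top]; trivial
    induction hx using Algebra.adjoin_induction with
    | mem x hx =>
      rcases hx with ⟨b, rfl⟩ | ⟨b, rfl⟩
      · have e (u : B ⊗[k] B) : F (TensorProduct.map (m k B).toLinearMap (m k B).toLinearMap u) =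
            LinearMap.mul' k (PoissonEnv k B) (TensorProduct.map (cs k B).ofConv (cm k B).ofConv u) := by
          induction u with
          | zero => simp
          | add u v hu hv => simp only [map_add, hu, hv]
          | tmul a b => simp [F, cs, cm]
        rw [comul_m, e, counit_m]
        exact congr($(cs_mul_cm k B) b)
      · have e (u : B ⊗[k] B) : F ((TensorProduct.map (m k B).toLinearMap (h k B) +
            TensorProduct.map (h k B) (m k B).toLinearMap) u) =
            LinearMap.mul' k (PoissonEnv k B) (TensorProduct.map (cs k B).ofConv (ch k B).ofConv u) +
            LinearMap.mul' k (PoissonEnv k B) (TensorProduct.map (ct k B).ofConv (cm k B).ofConv u) := by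
          induction u with
          | zero => simp
          | add u v hu hv => simp only [map_add, hu, hv]; abel
          | tmul a b => simp [F, cs, cm, ch]
        rw [comul_h, e, counit_h, map_zero]
        have : cs k B * ch k B + ct k B * cm k B = 0 := by rw [ct_mul_cm, add_neg_cancel]
        exact congr($this b)
    | algebraMap r =>
      rw [Bialgebra.comul_algebraMap, Algebra.algebraMap_eq_smul_one, map_smul,
        Bialgebra.counit_algebraMap, Algebra.algebraMap_eq_smul_one,
        Algebra.TensorProduct.one_def]
      simp [F, antipodeLin_one]
    | add x y _ _ hx hy => simp only [map_add, hx, hy]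
    | mul x y _ _ hx hy =>
      rw [Bialgebra.comul_mul, hF₂ _ _ _ hx, hy, Bialgebra.counit_mul, map_mul, Algebra.smul_def]
  ext x; exact hF₃ x

theorem antipode_right : LinearMap.mul' k (PoissonEnv k B) ∘ₗ (antipodeLin k B).lTensor (PoissonEnv k B) ∘ₗ Coalgebra.comul =
    Algebra.linearMap k (PoissonEnv k B) ∘ₗ Coalgebra.counit := by
  let F : (PoissonEnv k B) ⊗[k] (PoissonEnv k B) →ₗ[k] (PoissonEnv k B) := LinearMap.mul' k (PoissonEnv k B) ∘ₗ (antipodeLin k B).lTensor (PoissonEnv k B)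
  have hF₁ (u : (PoissonEnv k B) ⊗[k] (PoissonEnv k B)) (c d : (PoissonEnv k B)) : F (c ⊗ₜ d * u) = c * F u * antipodeLin k B d := by
    induction u with
    | zero => simp
    | add u v hu hv => simp only [add_mul, mul_add, map_add, hu, hv]
    | tmul a b => simp [F, antipodeLin_mul, mul_assoc]
  have hF₂ (u v : (PoissonEnv k B) ⊗[k] (PoissonEnv k B)) (r : k) (hv : F v = algebraMap k (PoissonEnv k B) r) : F (u * v) = r • F u := by
    induction u with
    | zero => simp
    | add v w hv hw => simp only [add_mul, map_add, smul_add, hv, hw]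
    | tmul a b => rw [hF₁, hv, ← Algebra.commutes, mul_assoc, ← Algebra.smul_def]; simp [F]
  have hF₃ (x : (PoissonEnv k B)) : F (Coalgebra.comul x) = algebraMap k (PoissonEnv k B) (Coalgebra.counit x) := by
    have hx : x ∈ Algebra.adjoin k (Set.range (m k B) ∪ Set.range (h k B)) := by
      rw [adjoin_eq_top]; trivial
    induction hx using Algebra.adjoin_induction with
    | mem x hx =>
      rcases hx with ⟨b, rfl⟩ | ⟨b, rfl⟩
      · have e (u : B ⊗[k] B) : F (TensorProduct.map (m k B).toLinearMap (m k B).toLinearMap u) =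
            LinearMap.mul' k (PoissonEnv k B) (TensorProduct.map (cm k B).ofConv (cs k B).ofConv u) := by
          induction u with
          | zero => simp
          | add u v hu hv => simp only [map_add, hu, hv]
          | tmul a b => simp [F, cs, cm]
        rw [comul_m, e, counit_m]
        exact congr($(cm_mul_cs k B) b)
      · have e (u : B ⊗[k] B) : F ((TensorProduct.map (m k B).toLinearMap (h k B) +
            TensorProduct.map (h k B) (m k B).toLinearMap) u) =
            LinearMap.mul' k (PoissonEnv k B) (TensorProduct.map (cm k B).ofConv (ct k B).ofConv u) +
            LinearMap.mul' k (PoissonEnv k B) (TensorProduct.map (ch k B).ofConv (cs k B).ofConv u) := by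
          induction u with
          | zero => simp
          | add u v hu hv => simp only [map_add, hu, hv]; abel
          | tmul a b => simp [F, cs, cm, ch]
        rw [comul_h, e, counit_h, map_zero]
        have : cm k B * ct k B + ch k B * cs k B = 0 := by rw [cm_mul_ct, neg_add_cancel]
        exact congr($this b)
    | algebraMap r =>
      rw [Bialgebra.comul_algebraMap, Algebra.algebraMap_eq_smul_one, map_smul,
        Bialgebra.counit_algebraMap, Algebra.algebraMap_eq_smul_one,
        Algebra.TensorProduct.one_def]
      simp [F, antipodeLin_one]
    | add x y _ _ hx hy => simp only [map_add, hx, hy]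
    | mul x y _ _ hx hy =>
      rw [Bialgebra.comul_mul, hF₂ _ _ _ hy, hx, Bialgebra.counit_mul, map_mul, Algebra.smul_def,
        Algebra.commutes]
  ext x; exact hF₃ x

/-- The Hopf algebra structure on `B^e`. The antipode of a bialgebra is unique; here it is given by
`S m_b = m_{S b}` and `S h_b = - m_{S b₁} h_{b₂} m_{S b₃}`. -/
instance : HopfAlgebra k (PoissonEnv k B) where
  antipode := antipodeLin k B
  mul_antipode_rTensor_comul := antipode_left k B
  mul_antipode_lTensor_comul := antipode_right k B

end Hopf

end PoissonEnv

/-! ### The coradical of a coalgebra -/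

section Coradical

variable (k : Type*) {C : Type*} [Field k] [AddCommGroup C] [Module k C] [Coalgebra k C]

/-- A subspace `D` of a coalgebra is a subcoalgebra if `Δ D ⊆ D ⊗ D`, where `D ⊗ D` is regarded
as a subspace of `C ⊗ C`. -/
def IsSubcoalgebra (D : Submodule k C) : Prop :=
  ∀ x ∈ D, Coalgebra.comul (R := k) x ∈ LinearMap.range (TensorProduct.map D.subtype D.subtype)

/-- A subcoalgebra is simple if it is nonzero and its only subcoalgebras are `0` and itself. -/
def IsSimpleSubcoalgebra (D : Submodule k C) : Prop :=
  IsSubcoalgebra k D ∧ D ≠ ⊥ ∧ ∀ D' ≤ D, IsSubcoalgebra k D' → D' = ⊥ ∨ D' = D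

variable (C)

/-- The coradical of a coalgebra: the sum of all its simple subcoalgebras. -/
def coradical : Submodule k C := sSup {D : Submodule k C | IsSimpleSubcoalgebra k D}

/-- The set `G(C)` of group-like elements of a coalgebra. -/
def groupLikeSet : Set C := {g : C | IsGroupLikeElem k g}

/-- A coalgebra is pointed if its coradical is spanned by the group-like elements. -/
def IsPointedCoalgebra : Prop := coradical k C = Submodule.span k (groupLikeSet k C)

end Coradical

end

/-! Everything reduces to one claim: a simple subcoalgebra of `B^e` is contained in `m(B)`. Since
`m` is an injective coalgebra map, the simple subcoalgebras of `B^e` are then exactly the images of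
those of `B`, and the coradicals correspond (`coradical_eq_map`).

For the claim, filter `B^e` by the number of factors `h_b`: `F 0 = 0`, `F 1 = m(B)`, `F (n + 1) =
m(B) + h(B) * F n`. Moving `m_b` past `h_c` costs only an element of `m(B)`, so the `F n` are stable
under left multiplication by `m(B)` and exhaust `B^e`. As `Δ h_b` lies in `m(B) ⊗ h(B) + h(B) ⊗
m(B)`, multiplication by it either adds an `h` on the right tensor factor or leaves that factor in
the same step; this gives `Δ (F (n + 1)) ⊆ m(B) ⊗ F (n + 1) + B^e ⊗ F n`.

Such a filtration forces every nonzero subcoalgebra `D` to meet `E = m(B)`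
(`IsSubcoalgebra.inf_ne_bot_of_filtration`). If `D ∩ E = 0`, some functional `f` is the counit on
`D` and zero on `E`. Then `(f ⊗ id) Δ` is the identity on `D` but maps `F (n + 1)` into `F n`,
whence `D ∩ F n = 0` for all `n` and `D = 0`. For `D` simple, `D ∩ E` is a nonzero subcoalgebra of
`D`, hence equals `D`.

A group-like element spans a simple subcoalgebra, so the group-like elements of `B^e` also lie in
`m(B)` and come from `B`. -/

section SubcoalgebraBasics

open Coalgebra

variable {k V C : Type*} [Field k] [AddCommGroup V] [Module k V] [AddCommGroup C] [Module k C]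

/-! ### Linear algebra of subspaces and their tensor squares -/

/-- Two subspaces admit a projection onto the second one which maps the first one into their
intersection. -/
theorem Submodule.exists_projection_mem_inf (D E : Submodule k V) :
    ∃ p : V →ₗ[k] V, (∀ x ∈ E, p x = x) ∧ ∀ x ∈ D, p x ∈ D ⊓ E := by
  -- By modularity `D = (D ⊓ E) ⊕ (W ⊓ D)`. The complement `Q` of `E` is chosen to contain `W ⊓ D`,
  -- so the projection onto `E` along `Q` fixes the first summand and kills the second.
  obtain ⟨W, hW⟩ := (D ⊓ E).exists_isCompl
  have hdis : Disjoint (W ⊓ D) E := by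
    rw [disjoint_iff, inf_assoc, inf_comm]
    exact hW.inf_eq_bot
  obtain ⟨Q, hQ, hQE⟩ := hdis.exists_isCompl
  refine ⟨E.projection Q hQE.symm, fun x hx => E.projection_apply_of_mem_left hQE.symm hx, ?_⟩
  intro x hx
  obtain ⟨a, ha, b, hb, rfl⟩ := Submodule.mem_sup.1 (hW.sup_eq_top ▸ Submodule.mem_top (x := x))
  have hbD : b ∈ D := by simpa using D.sub_mem hx ha.1
  have hbQ : E.projection Q hQE.symm b = 0 :=
    (Submodule.projection_apply_eq_zero_iff hQE.symm).2 (hQ ⟨hb, hbD⟩)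
  rw [map_add, E.projection_apply_of_mem_left hQE.symm ha.2, hbQ, add_zero]
  exact ha

/-- A linear map given on `E` by `q` and vanishing on a subspace disjoint from `E`. -/
theorem LinearMap.exists_eqOn_of_disjoint {D E : Submodule k V} (h : Disjoint D E)
    (g : V →ₗ[k] C) :
    ∃ f : V →ₗ[k] C, (∀ x ∈ D, f x = g x) ∧ ∀ x ∈ E, f x = 0 := by
  obtain ⟨Q, hQ, hQE⟩ := h.exists_isCompl
  refine ⟨g ∘ₗ Q.projection E hQE, fun x hx => ?_, fun x hx => ?_⟩
  · rw [LinearMap.comp_apply, Q.projection_apply_of_mem_left hQE (hQ hx)]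
  · rw [LinearMap.comp_apply, (Submodule.projection_apply_eq_zero_iff hQE).2 hx, map_zero]

theorem TensorProduct.map_mem_map₂_mk {D D' E E' : Submodule k V} {f g : V →ₗ[k] V}
    (hf : ∀ x ∈ D, f x ∈ D') (hg : ∀ x ∈ E, g x ∈ E') {t : V ⊗[k] V}
    (ht : t ∈ Submodule.map₂ (TensorProduct.mk k V V) D E) :
    TensorProduct.map f g t ∈ Submodule.map₂ (TensorProduct.mk k V V) D' E' := by
  suffices Submodule.map₂ (TensorProduct.mk k V V) D E ≤
      (Submodule.map₂ (TensorProduct.mk k V V) D' E').comap (TensorProduct.map f g) from this ht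
  refine Submodule.map₂_le.2 fun x hx y hy => ?_
  exact Submodule.apply_mem_map₂ (TensorProduct.mk k V V) (hf x hx) (hg y hy)

theorem TensorProduct.map_eq_self_of_mem_map₂_mk {E : Submodule k V} {p : V →ₗ[k] V}
    (hp : ∀ x ∈ E, p x = x) {t : V ⊗[k] V}
    (ht : t ∈ Submodule.map₂ (TensorProduct.mk k V V) E E) : TensorProduct.map p p t = t := by
  suffices Submodule.map₂ (TensorProduct.mk k V V) E E ≤
      LinearMap.eqLocus (TensorProduct.map p p) LinearMap.id from this ht
  refine Submodule.map₂_le.2 fun x hx y hy => ?_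
  simp [hp x hx, hp y hy]

/-! ### Subcoalgebras and their transport along injective coalgebra maps -/

variable [Coalgebra k V] [Coalgebra k C]

/-- In the `Submodule.map₂` form, inclusions out of `D ⊗ D` can be checked on pure tensors through
`Submodule.map₂_le`. -/
theorem isSubcoalgebra_iff_comul_mem_map₂ {D : Submodule k C} :
    IsSubcoalgebra k D ↔
      ∀ x ∈ D, comul (R := k) x ∈ Submodule.map₂ (TensorProduct.mk k C C) D D := by
  rw [IsSubcoalgebra, TensorProduct.range_map, Submodule.range_subtype]

/-- Over a field, an element of both `D ⊗ D` and `E ⊗ E` lies in `(D ⊓ E) ⊗ (D ⊓ E)`: with `p` as in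
`Submodule.exists_projection_mem_inf`, the map `p ⊗ p` fixes `E ⊗ E` pointwise and carries `D ⊗ D`
into the tensor square of the intersection. -/
theorem IsSubcoalgebra.inf {D E : Submodule k C} (hD : IsSubcoalgebra k D)
    (hE : IsSubcoalgebra k E) : IsSubcoalgebra k (D ⊓ E) := by
  rw [isSubcoalgebra_iff_comul_mem_map₂] at *
  intro x hx
  obtain ⟨p, hpE, hpD⟩ := D.exists_projection_mem_inf E
  rw [← TensorProduct.map_eq_self_of_mem_map₂_mk hpE (hE x hx.2)]
  exact TensorProduct.map_mem_map₂_mk hpD hpD (hD x hx.1)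

/-- A simple subcoalgebra which meets a subcoalgebra `E` is contained in `E`. -/
theorem IsSimpleSubcoalgebra.le_of_inf_ne_bot {D E : Submodule k C}
    (hD : IsSimpleSubcoalgebra k D) (hE : IsSubcoalgebra k E) (h : D ⊓ E ≠ ⊥) : D ≤ E :=
  inf_eq_left.1 ((hD.2.2 _ inf_le_left (hD.1.inf hE)).resolve_left h)

/-- The tensor square of `D.map φ` is the image of `D ⊗ D` under `φ ⊗ φ`, and `φ ⊗ φ` is injective
by flatness over a field, so the condition on `Δ (φ x)` can be cancelled back to one on `Δ x`. -/
theorem isSubcoalgebra_map_iff {φ : V →ₗ[k] C} (hinj : Function.Injective φ)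
    (hφ : ∀ x, comul (R := k) (φ x) = TensorProduct.map φ φ (comul (R := k) x))
    {D : Submodule k V} : IsSubcoalgebra k (D.map φ) ↔ IsSubcoalgebra k D := by
  have hinj' : Function.Injective (TensorProduct.map φ φ) :=
    TensorProduct.map_injective_of_flat_flat φ φ hinj hinj
  have hmap : Submodule.map₂ (TensorProduct.mk k C C) (D.map φ) (D.map φ) =
      (Submodule.map₂ (TensorProduct.mk k V V) D D).map (TensorProduct.map φ φ) := by
    rw [Submodule.map_map₂, Submodule.map₂_map_map]
    rfl
  simp only [isSubcoalgebra_iff_comul_mem_map₂, hmap, Submodule.mem_map, forall_exists_index,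
    and_imp, forall_apply_eq_imp_iff₂, hφ, hinj'.eq_iff, exists_eq_right]

theorem isSimpleSubcoalgebra_map_iff {φ : V →ₗ[k] C} (hinj : Function.Injective φ)
    (hφ : ∀ x, comul (R := k) (φ x) = TensorProduct.map φ φ (comul (R := k) x))
    {D : Submodule k V} : IsSimpleSubcoalgebra k (D.map φ) ↔ IsSimpleSubcoalgebra k D := by
  have hmap := Submodule.map_injective_of_injective hinj
  have hbot {E : Submodule k V} : E.map φ = ⊥ ↔ E = ⊥ := hmap.eq_iff' (Submodule.map_bot φ)
  refine and_congr (isSubcoalgebra_map_iff hinj hφ) (and_congr ?_ ⟨fun h D' hD' hs => ?_,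
    fun h D' hD' hs => ?_⟩)
  · rw [Ne, Ne, hbot]
  · refine (h _ (Submodule.map_mono hD') ((isSubcoalgebra_map_iff hinj hφ).2 hs)).imp ?_ ?_
    · exact hbot.1
    · exact fun e => hmap e
  -- A subspace of `D.map φ` lies in the range of `φ`, so it is the image of its preimage; no new
  -- subcoalgebras appear below `D.map φ`.
  · obtain ⟨D', rfl⟩ : ∃ D'' : Submodule k V, D''.map φ = D' :=
      ⟨D'.comap φ, Submodule.map_comap_eq_self (hD'.trans LinearMap.map_le_range)⟩
    rw [isSubcoalgebra_map_iff hinj hφ] at hs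
    refine (h _ ((Submodule.map_le_map_iff_of_injective hinj _ _).1 hD') hs).imp ?_ ?_
    · rintro rfl; exact Submodule.map_bot φ
    · rintro rfl; rfl

/-- If every simple subcoalgebra of `C` lies in the image of an injective coalgebra map, the
coradical of `C` is the image of the coradical of the source. -/
theorem coradical_eq_map {φ : V →ₗ[k] C} (hinj : Function.Injective φ)
    (hφ : ∀ x, comul (R := k) (φ x) = TensorProduct.map φ φ (comul (R := k) x))
    (hle : ∀ D : Submodule k C, IsSimpleSubcoalgebra k D → D ≤ LinearMap.range φ) :
    coradical k C = (coradical k V).map φ := by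
  apply le_antisymm
  · refine sSup_le fun D hD => ?_
    obtain ⟨D, rfl⟩ : ∃ D' : Submodule k V, D'.map φ = D :=
      ⟨D.comap φ, Submodule.map_comap_eq_self (hle D hD)⟩
    exact Submodule.map_mono (le_sSup ((isSimpleSubcoalgebra_map_iff hinj hφ).1 hD))
  · rw [Submodule.map_le_iff_le_comap]
    refine sSup_le fun D hD => ?_
    rw [← Submodule.map_le_iff_le_comap]
    exact le_sSup ((isSimpleSubcoalgebra_map_iff hinj hφ).2 hD)

/-! ### Group-like elements -/

/-- The line through `g` is a subcoalgebra because `Δ g = g ⊗ g`, and it is simple because a line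
has no proper nonzero subspace. -/
theorem IsGroupLikeElem.mem_coradical {g : C} (hg : IsGroupLikeElem k g) :
    g ∈ coradical k C := by
  refine (le_sSup (a := Submodule.span k {g}) ⟨?_, ?_, fun D hD _ => ?_⟩ :
    _ ≤ coradical k C) (Submodule.mem_span_singleton_self g)
  · rw [isSubcoalgebra_iff_comul_mem_map₂]
    intro x hx
    obtain ⟨r, rfl⟩ := Submodule.mem_span_singleton.1 hx
    rw [map_smul, hg.comul_eq_tmul_self]
    exact Submodule.smul_mem _ r (Submodule.apply_mem_map₂ (TensorProduct.mk k C C)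
      (Submodule.mem_span_singleton_self g) (Submodule.mem_span_singleton_self g))
  · simpa using hg.ne_zero
  · by_cases h : g ∈ D
    · exact Or.inr (le_antisymm hD ((Submodule.span_singleton_le_iff_mem _ _).2 h))
    · refine Or.inl ((Submodule.eq_bot_iff _).2 fun x hx => ?_)
      obtain ⟨r, rfl⟩ := Submodule.mem_span_singleton.1 (hD hx)
      by_cases hr : r = 0
      · rw [hr, zero_smul]
      · exact absurd ((D.smul_mem_iff hr).1 hx) h

/-- Injectivity of `φ ⊗ φ` allows `Δ x = x ⊗ x` to be tested after applying it. -/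
theorem isGroupLikeElem_of_map {φ : V →ₗ[k] C} (hinj : Function.Injective φ)
    (hφ : ∀ x, comul (R := k) (φ x) = TensorProduct.map φ φ (comul (R := k) x))
    (hε : ∀ x, counit (R := k) (φ x) = counit (R := k) x) {x : V}
    (hx : IsGroupLikeElem k (φ x)) : IsGroupLikeElem k x where
  counit_eq_one := (hε x).symm.trans hx.counit_eq_one
  comul_eq_tmul_self := TensorProduct.map_injective_of_flat_flat φ φ hinj hinj <| by
    rw [← hφ, hx.comul_eq_tmul_self, TensorProduct.map_tmul]

theorem isGroupLikeElem_map {φ : V →ₗ[k] C}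
    (hφ : ∀ x, comul (R := k) (φ x) = TensorProduct.map φ φ (comul (R := k) x))
    (hε : ∀ x, counit (R := k) (φ x) = counit (R := k) x) {x : V}
    (hx : IsGroupLikeElem k x) : IsGroupLikeElem k (φ x) where
  counit_eq_one := (hε x).trans hx.counit_eq_one
  comul_eq_tmul_self := by rw [hφ, hx.comul_eq_tmul_self, TensorProduct.map_tmul]

/-! ### Subcoalgebras and filtrations -/

/-- Let `0 = F 0 ≤ F 1 ≤ ⋯` be an exhaustive filtration of a coalgebra with
`Δ (F (n + 1)) ⊆ E ⊗ C + C ⊗ F n`. Then every nonzero subcoalgebra meets `E`. -/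
theorem IsSubcoalgebra.inf_ne_bot_of_filtration {D E : Submodule k C} (F : ℕ → Submodule k C)
    (hF₀ : F 0 = ⊥) (hF : ∀ x, ∃ n, x ∈ F n)
    (hΔ : ∀ n, ∀ x ∈ F (n + 1), comul (R := k) x ∈
      Submodule.map₂ (TensorProduct.mk k C C) E ⊤ ⊔
        Submodule.map₂ (TensorProduct.mk k C C) ⊤ (F n))
    (hD : IsSubcoalgebra k D) (hD₀ : D ≠ ⊥) : D ⊓ E ≠ ⊥ := by
  intro hDE
  -- The assumption `D ⊓ E = ⊥` is what allows the two prescriptions on `f` to coexist: the counit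
  -- on `D`, zero on `E`.
  obtain ⟨f, hfD, hfE⟩ := LinearMap.exists_eqOn_of_disjoint (disjoint_iff.2 hDE)
    (counit (R := k) (A := C))
  let T : C ⊗[k] C →ₗ[k] C := (TensorProduct.lid k C).toLinearMap ∘ₗ f.rTensor C
  -- On `D ⊗ D` the functional `f` cannot be told from the counit, so this is the counit axiom.
  have hTD (x : C) (hx : x ∈ D) : T (comul x) = x := by
    have e : Submodule.map₂ (TensorProduct.mk k C C) D D ≤ LinearMap.eqLocus T
        ((TensorProduct.lid k C).toLinearMap ∘ₗ counit.rTensor C) :=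
      Submodule.map₂_le.2 fun a ha b _ => by simp [T, hfD a ha]
    refine (e (isSubcoalgebra_iff_comul_mem_map₂.1 hD x hx)).trans ?_
    simp
  -- `T` kills `E ⊗ C` and only rescales right factors in `C ⊗ F n`, so `T ∘ Δ` lowers the
  -- filtration by one.
  have hTF (n : ℕ) : Submodule.map₂ (TensorProduct.mk k C C) E ⊤ ⊔
      Submodule.map₂ (TensorProduct.mk k C C) ⊤ (F n) ≤ (F n).comap T := by
    refine sup_le (Submodule.map₂_le.2 fun a ha b _ => ?_)
      (Submodule.map₂_le.2 fun a _ b hb => ?_)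
    · simp [T, hfE a ha]
    · simpa [T] using (F n).smul_mem _ hb
  -- For `x` in `D ⊓ F (n + 1)`, the two facts give `x = T (Δ x) ∈ F n`, and the induction descends
  -- to `F 0 = ⊥`.
  have hDF (n : ℕ) : D ⊓ F n = ⊥ := by
    induction n with
    | zero => rw [hF₀, inf_bot_eq]
    | succ n ih =>
      refine (Submodule.eq_bot_iff _).2 fun x hx => ?_
      have h := hTF n (hΔ n x hx.2)
      rw [Submodule.mem_comap, hTD x hx.1] at h
      exact (Submodule.eq_bot_iff _).1 ih x ⟨hx.1, h⟩
  refine hD₀ ((Submodule.eq_bot_iff _).2 fun x hx => ?_)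
  obtain ⟨n, hn⟩ := hF x
  exact (Submodule.eq_bot_iff _).1 (hDF n) x ⟨hx, hn⟩

end SubcoalgebraBasics

namespace PoissonEnv

open PoissonAlgebra

/-! ### The filtration of the enveloping algebra by the number of factors `h_b` -/

section Filtration

variable (k B : Type*) [Field k] [CommRing B] [Algebra k B] [PoissonAlgebra k B]

/-- The filtration of `B^e` by the number of factors `h_b`, shifted by one: `hFiltration 0 = 0`
and `hFiltration (n + 1) = m(B) + h(B) * hFiltration n`. -/
def hFiltration : ℕ → Submodule k (PoissonEnv k B)
  | 0 => ⊥
  | n + 1 => LinearMap.range (m k B).toLinearMap ⊔ LinearMap.range (h k B) * hFiltration n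

variable {k B}

theorem m_mem_hFiltration (n : ℕ) (b : B) : m k B b ∈ hFiltration k B (n + 1) :=
  Submodule.mem_sup_left ⟨b, rfl⟩

theorem h_mul_mem_hFiltration {n : ℕ} (b : B) {x : PoissonEnv k B}
    (hx : x ∈ hFiltration k B n) : h k B b * x ∈ hFiltration k B (n + 1) :=
  Submodule.mem_sup_right (Submodule.mul_mem_mul ⟨b, rfl⟩ hx)

theorem hFiltration_succ_le {n : ℕ} {P : Submodule k (PoissonEnv k B)}
    (hm : ∀ b, m k B b ∈ P) (hh : ∀ b, ∀ x ∈ hFiltration k B n, h k B b * x ∈ P) :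
    hFiltration k B (n + 1) ≤ P := by
  refine sup_le ?_ (Submodule.mul_le.2 ?_)
  · rintro _ ⟨b, rfl⟩; exact hm b
  · rintro _ ⟨b, rfl⟩ x hx; exact hh b x hx

theorem hFiltration_le_succ (n : ℕ) : hFiltration k B n ≤ hFiltration k B (n + 1) := by
  induction n with
  | zero => exact bot_le
  | succ n ih =>
    exact hFiltration_succ_le (m_mem_hFiltration _)
      fun b x hx => h_mul_mem_hFiltration b (ih hx)

theorem hFiltration_mono : Monotone (hFiltration k B) :=
  monotone_nat_of_le_succ hFiltration_le_succ

/-- The filtration is built by multiplying by `h` on the left, so `m_b` has to be moved past `h_c`: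
`m_b h_c = h_c m_b - m_{{c, b}}`. The correction has one factor `h` fewer, and is covered by the
induction because `b` is generalized. -/
theorem m_mul_mem_hFiltration {n : ℕ} (b : B) {x : PoissonEnv k B}
    (hx : x ∈ hFiltration k B n) : m k B b * x ∈ hFiltration k B n := by
  induction n generalizing b x with
  | zero =>
    obtain rfl : x = 0 := hx
    rw [mul_zero]
    exact zero_mem _
  | succ n ih =>
    suffices hFiltration k B (n + 1) ≤
        (hFiltration k B (n + 1)).comap (LinearMap.mulLeft k (m k B b)) from this hx
    refine hFiltration_succ_le (fun c => ?_) fun c y hy => ?_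
    · rw [Submodule.mem_comap, LinearMap.mulLeft_apply, ← map_mul]
      exact m_mem_hFiltration n _
    · have e : m k B b * (h k B c * y) =
          h k B c * (m k B b * y) - m k B (bracket k c b) * y := by
        rw [m_bracket]; noncomm_ring
      rw [Submodule.mem_comap, LinearMap.mulLeft_apply, e]
      exact Submodule.sub_mem _ (h_mul_mem_hFiltration c (ih b hy))
        (hFiltration_le_succ n (ih _ hy))

theorem exists_mem_hFiltration (x : PoissonEnv k B) : ∃ n, x ∈ hFiltration k B n := by
  have hx : x ∈ Algebra.adjoin k (Set.range (m k B) ∪ Set.range (h k B)) := by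
    rw [adjoin_eq_top]; trivial
  -- Only left multiplication by the generators is under control, so the induction over the
  -- generated algebra runs on left multiplication by `x`; the value at `y = m_1 = 1` then gives the
  -- result.
  have key : ∀ n, ∀ y ∈ hFiltration k B n, ∃ n', x * y ∈ hFiltration k B n' := by
    induction hx using Algebra.adjoin_induction with
    | mem x hx =>
      intro n y hy
      rcases hx with ⟨b, rfl⟩ | ⟨b, rfl⟩
      · exact ⟨n, m_mul_mem_hFiltration b hy⟩
      · exact ⟨n + 1, h_mul_mem_hFiltration b hy⟩
    | algebraMap r =>
      intro n y hy
      exact ⟨n, by rw [← Algebra.smul_def]; exact Submodule.smul_mem _ r hy⟩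
    | add x₁ x₂ _ _ h₁ h₂ =>
      intro n y hy
      obtain ⟨i, hi⟩ := h₁ n y hy
      obtain ⟨j, hj⟩ := h₂ n y hy
      refine ⟨max i j, ?_⟩
      rw [add_mul]
      exact Submodule.add_mem _ (hFiltration_mono (le_max_left i j) hi)
        (hFiltration_mono (le_max_right i j) hj)
    | mul x₁ x₂ _ _ h₁ h₂ =>
      intro n y hy
      obtain ⟨i, hi⟩ := h₂ n y hy
      obtain ⟨j, hj⟩ := h₁ i _ hi
      exact ⟨j, by rwa [mul_assoc]⟩
  obtain ⟨n, hn⟩ := key 1 (m k B 1) (m_mem_hFiltration 0 1)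
  exact ⟨n, by simpa using hn⟩

end Filtration

/-! ### Coradical and group-like elements of the enveloping algebra -/

section Coradical

variable {k B : Type*} [Field k] [CommRing B] [HopfAlgebra k B] [PoissonAlgebra k B]
  [IsPoissonBialgebra k B]

/-- The filtration by the number of factors `h_b` is a coalgebra filtration, in the weak form
`Δ (F (n + 1)) ⊆ m(B) ⊗ F (n + 1) + B^e ⊗ F n`. -/
theorem comul_mem_of_mem_hFiltration (n : ℕ) {x : PoissonEnv k B}
    (hx : x ∈ hFiltration k B (n + 1)) : Coalgebra.comul (R := k) x ∈
      Submodule.map₂ (TensorProduct.mk k (PoissonEnv k B) (PoissonEnv k B))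
          (LinearMap.range (m k B).toLinearMap) (hFiltration k B (n + 1)) ⊔
        Submodule.map₂ (TensorProduct.mk k (PoissonEnv k B) (PoissonEnv k B))
          ⊤ (hFiltration k B n) := by
  induction n generalizing x with
  | zero =>
    rw [← Submodule.mem_comap]
    refine hFiltration_succ_le (fun b => ?_) (fun b y hy => ?_) hx
    · rw [Submodule.mem_comap, comul_m]
      refine Submodule.mem_sup_left ?_
      generalize Coalgebra.comul (R := k) b = u
      -- With `Δ b` replaced by an arbitrary tensor, linearity reduces the membership to pure
      -- tensors.
      induction u with
      | zero => rw [map_zero]; exact zero_mem _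
      | add u v hu hv => rw [map_add]; exact Submodule.add_mem _ hu hv
      | tmul a b =>
        exact Submodule.apply_mem_map₂ (TensorProduct.mk k _ _) ⟨a, rfl⟩ (m_mem_hFiltration 0 b)
    · obtain rfl : y = 0 := hy
      rw [mul_zero]
      exact zero_mem _
  | succ n ih =>
    rw [← Submodule.mem_comap]
    refine hFiltration_succ_le (fun b => ?_) (fun b y hy => ?_) hx
    -- `m_b` already lies in `F (n + 1)`, so the bound one step lower applies and is enlarged by
    -- monotonicity.
    · refine SetLike.le_def.1 (sup_le_sup ?_ ?_) (ih (m_mem_hFiltration n b)) <;>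
        exact Submodule.map₂_le_map₂_right (hFiltration_le_succ _)
    · rw [Submodule.mem_comap, Bialgebra.comul_mul, comul_h]
      generalize Coalgebra.comul (R := k) b = u
      induction u with
      | zero => rw [map_zero, zero_mul]; exact zero_mem _
      | add u v hu hv => rw [map_add, add_mul]; exact Submodule.add_mem _ hu hv
      | tmul a c =>
        rw [← LinearMap.mulLeft_apply (R := k), ← Submodule.mem_comap]
        refine SetLike.le_def.1 (sup_le ?_ ?_) (ih hy) <;> refine Submodule.map₂_le.2 ?_
        -- On `m_d ⊗ z` with `z ∈ F (n + 1)`: the term `m_a m_d ⊗ h_c z` stays in `m(B) ⊗ F (n +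
        -- 2)`, while `h_a m_d ⊗ m_c z` may leave `m(B)` on the left and must go to `B^e ⊗ F (n +
        -- 1)`. This is why the first summand of the statement records `F (n + 1)` and not just
        -- `B^e`.
        · rintro _ ⟨d, rfl⟩ z hz
          simp only [Submodule.mem_comap, LinearMap.mulLeft_apply, LinearMap.add_apply,
            TensorProduct.map_tmul, TensorProduct.mk_apply, add_mul,
            Algebra.TensorProduct.tmul_mul_tmul, AlgHom.toLinearMap_apply, ← map_mul]
          refine Submodule.add_mem _ (Submodule.mem_sup_left ?_) (Submodule.mem_sup_right ?_)
          · exact Submodule.apply_mem_map₂ (TensorProduct.mk k _ _) ⟨a * d, rfl⟩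
              (h_mul_mem_hFiltration c hz)
          · exact Submodule.apply_mem_map₂ (TensorProduct.mk k _ _) trivial
              (m_mul_mem_hFiltration c hz)
        -- On `w ⊗ z` with `z ∈ F n`, at most one `h` is added to the right factor, so both terms
        -- end in `B^e ⊗ F (n + 1)`.
        · intro w _ z hz
          simp only [Submodule.mem_comap, LinearMap.mulLeft_apply, LinearMap.add_apply,
            TensorProduct.map_tmul, TensorProduct.mk_apply, add_mul,
            Algebra.TensorProduct.tmul_mul_tmul, AlgHom.toLinearMap_apply]
          refine Submodule.mem_sup_right (Submodule.add_mem _ ?_ ?_)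
          · exact Submodule.apply_mem_map₂ (TensorProduct.mk k _ _) trivial
              (h_mul_mem_hFiltration c hz)
          · exact Submodule.apply_mem_map₂ (TensorProduct.mk k _ _) trivial
              (hFiltration_le_succ n (m_mul_mem_hFiltration c hz))

theorem isSubcoalgebra_range_m :
    IsSubcoalgebra k (LinearMap.range (m k B).toLinearMap) := by
  rintro _ ⟨b, rfl⟩
  rw [AlgHom.toLinearMap_apply, comul_m, TensorProduct.range_map, Submodule.range_subtype,
    ← TensorProduct.range_map]
  exact ⟨_, rfl⟩

theorem le_range_m_of_isSimpleSubcoalgebra {D : Submodule k (PoissonEnv k B)}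
    (hD : IsSimpleSubcoalgebra k D) : D ≤ LinearMap.range (m k B).toLinearMap := by
  refine hD.le_of_inf_ne_bot isSubcoalgebra_range_m ?_
  refine hD.1.inf_ne_bot_of_filtration (hFiltration k B) rfl exists_mem_hFiltration
    (fun n x hx => ?_) hD.2.1
  -- The control on the right factor of `m(B) ⊗ F (n + 1)` has served the induction and can now be
  -- dropped.
  have hle := Submodule.map₂_le_map₂_right (f := TensorProduct.mk k _ _)
    (p := LinearMap.range (m k B).toLinearMap) (le_top (a := hFiltration k B (n + 1)))
  exact sup_le_sup_right hle _ (comul_mem_of_mem_hFiltration n hx)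

variable (k B) in
theorem coradical_poissonEnv :
    coradical k (PoissonEnv k B) = (coradical k B).map (m k B).toLinearMap :=
  coradical_eq_map m_injective (comul_m k B) fun _ => le_range_m_of_isSimpleSubcoalgebra

variable (k B) in
-- Group-like elements lie in the coradical, and the coradical of `B^e` lies in `m(B)`; being
-- group-like is then reflected by the injective map `m`. Pointedness plays no role here.
theorem groupLikeSet_poissonEnv :
    groupLikeSet k (PoissonEnv k B) = m k B '' groupLikeSet k B := by
  ext g
  constructor
  · intro hg
    have hg' := IsGroupLikeElem.mem_coradical hg
    rw [coradical_poissonEnv] at hg'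
    obtain ⟨b, -, rfl⟩ := hg'
    exact ⟨b, isGroupLikeElem_of_map m_injective (comul_m k B) (counit_m k B) hg, rfl⟩
  · rintro ⟨b, hb, rfl⟩
    exact isGroupLikeElem_map (φ := (m k B).toLinearMap) (comul_m k B) (counit_m k B) hb

end Coradical

end PoissonEnv

theorem mainTheorem9 {k B : Type*} [Field k] [CommRing B] [HopfAlgebra k B] [PoissonAlgebra k B]
    [IsPoissonBialgebra k B] :
    coradical k (PoissonEnv k B) = (coradical k B).map (PoissonEnv.m k B).toLinearMap ∧
      (IsPointedCoalgebra k B →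
        IsPointedCoalgebra k (PoissonEnv k B) ∧
          groupLikeSet k (PoissonEnv k B) = PoissonEnv.m k B '' groupLikeSet k B) := by
  refine ⟨PoissonEnv.coradical_poissonEnv k B, fun hB =>
    ⟨?_, PoissonEnv.groupLikeSet_poissonEnv k B⟩⟩
  -- The image of the span of `G(B)` is the span of `m(G(B))`, which is `G(B^e)`.
  rw [IsPointedCoalgebra, PoissonEnv.coradical_poissonEnv, hB, Submodule.map_span,
    PoissonEnv.groupLikeSet_poissonEnv]
  rfl
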